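/- Let $n,m\ge 1$ be integers and let $s_1,\dots,s_m>0$. For $k=1,\dots,m$ let $A_k\colon[0,s_k]\to\mathbb{R}^{n\times n}$ be continuous on $[0,s_k]$ and real analytic on $(0,s_k)$. Let $$D=\{\Delta t=(\Delta t_1,\dots,\Delta t_m)\in\mathbb{R}^m : 0\le\Delta t_k\le s_k,\ k=1,\dots,m\}.$$ For $\Delta t\in D$ put $t_0=0$, $t_k=\sum_{\ell=1}^k\Delta t_\ell$, and let $A(t;\Delta t)=A_k(t-t_{k-1})$ for $t_{k-1}\le t<t_k$ $(k=1,\dots,m-1)$ and $A(t;\Delta t)=A_m(t-t_{m-1})$ for $t_{m-1}\le t\le t_m$. Let $\Phi(t,\tau;\Delta t)$ $(t,\tau\in[0,t_m])$ be the state transition matrix of $\dot x(t)=A(t;\Delta t)x(t)$, that is, the continuous solution of $$\frac{\partial}{\partial t}\Phi(t,\tau;\Delta t)=A(t;\Delta t)\,\Phi(t,\tau;\Delta t),\qquad \Phi(\tau,\tau;\Delta t)=I,$$ where at $t_0,\dots,t_m$ the derivatives are one-sided (the right derivative is taken with $A(t;\Delta t)$, the left derivative with the left limit of $A(\cdot;\Delta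 t)$ at $t$). For $p\in\mathbb{R}^n$ let $$W(p;\Delta t)=\int_0^{t_m}\Phi(t_m,\tau;\Delta t)\,\mathrm{diag}(p)\,\Phi(t_m,\tau;\Delta t)^\top\,\mathrm{d}\tau,$$ and let $\Delta=\{p\in\mathbb{R}^n: p_i\ge0\ (i=1,\dots,n),\ \sum_{i=1}^n p_i=1\}$. Consider the volumetric problem $$\text{minimise } -\log\det W(p;\Delta t)\quad\text{subject to } p\in\Delta,\ W(p;\Delta t)\succ O,$$ and the average energy problem $$\text{minimise } \mathrm{tr}\bigl(W(p;\Delta t)^{-1}\bigr)\quad\text{subject to } p\in\Delta,\ W(p;\Delta t)\succ O.$$ Let $\widetilde D_{\mathrm V}$ (respectively $\widetilde D_{\mathrm A}$) be the set of all $\Delta t\in D$ for which the volumetric (respectively the average energy) problem has exactly one optimal solution. Then each of $\widetilde D_{\mathrm V}$ and $\widetilde D_{\mathrm A}$ contains a dense open subset of $D$ (with respect to the subspace topology of $D\subset\mathbb{R}^m$). Furthermore, $D\setminus\widetilde D_{\mathrm V}$ and $D\setminus\widetilde D_{\mathrm A}$ have Lebesgue measure zero; therefore, for almost all $\Delta t\in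 D$, both problems have a unique optimal solution. -/

import Mathlib

open MeasureTheory Filter Topology Set

noncomputable section

namespace LTV

variable {n m : ℕ}

/-- The time `t_k = ∑_{ℓ ≤ k} Δt_ℓ` (durations are numbered from `0` here, so the sum runs over the
first `k` of them): `t_0 = 0`, and `t_m` is the final time. -/
def switchTime (Δt : Fin m → ℝ) (k : ℕ) : ℝ :=
  ∑ l : Fin m, if (l : ℕ) < k then Δt l else 0

/-- The set `D` of admissible duration tuples. -/
def admissible (s : Fin m → ℝ) : Set (Fin m → ℝ) :=
  {Δt | ∀ k, 0 ≤ Δt k ∧ Δt k ≤ s k}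

open Classical in
/-- The piecewise matrix `A(t; Δt)`. The piece with index `k : Fin m` is active for
`t_k ≤ t < t_{k+1}`, and the last piece is active at `t = t_m` too; exactly one piece is active at
each `t ∈ [0, t_m]`, so the sum has one term there. -/
def systemMatrix (A : Fin m → ℝ → Matrix (Fin n) (Fin n) ℝ) (Δt : Fin m → ℝ) (t : ℝ) :
    Matrix (Fin n) (Fin n) ℝ :=
  ∑ k : Fin m,
    if switchTime Δt k ≤ t ∧
        (t < switchTime Δt (k + 1) ∨ ((k : ℕ) + 1 = m ∧ t ≤ switchTime Δt m))
    then A k (t - switchTime Δt k) else 0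

/-- `Φ` is a state transition matrix of `ẋ(t) = F(t) x(t)` on `[0, T]`, where `F` may jump: it is
continuous, `Φ(τ, τ) = I`, and `∂Φ(t, τ)/∂t = F(t) Φ(t, τ)` in the sense of one-sided derivatives:
the right derivative is `F(t) Φ(t, τ)`, the left derivative is `F(t-) Φ(t, τ)` with the left limit
`F(t-)`. Where `F` is continuous this is the usual two-sided derivative. -/
structure IsStateTransition (F : ℝ → Matrix (Fin n) (Fin n) ℝ) (T : ℝ)
    (Φ : ℝ → ℝ → Matrix (Fin n) (Fin n) ℝ) : Prop where
  continuousOn : ContinuousOn (fun x : ℝ × ℝ => Φ x.1 x.2) (Icc 0 T ×ˢ Icc 0 T)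
  initial : ∀ τ ∈ Icc 0 T, Φ τ τ = 1
  right_deriv : ∀ τ ∈ Icc 0 T, ∀ t ∈ Ico 0 T, ∀ i j,
    HasDerivWithinAt (fun t' => Φ t' τ i j) ((F t * Φ t τ) i j) (Ici t) t
  left_deriv : ∀ τ ∈ Icc 0 T, ∀ t ∈ Ioc 0 T, ∃ L : Matrix (Fin n) (Fin n) ℝ,
    Tendsto F (𝓝[<] t) (𝓝 L) ∧
      ∀ i j, HasDerivWithinAt (fun t' => Φ t' τ i j) ((L * Φ t τ) i j) (Iic t) t

open Classical in
/-- The state transition matrix of `ẋ(t) = F(t) x(t)` on `[0, T]`. It is determined on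
`[0, T] × [0, T]` by its defining properties; `0` is a dummy value if there is none. -/
def stateTransition (F : ℝ → Matrix (Fin n) (Fin n) ℝ) (T : ℝ) :
    ℝ → ℝ → Matrix (Fin n) (Fin n) ℝ :=
  if h : ∃ Φ, IsStateTransition F T Φ then h.choose else 0

/-- The controllability Gramian
`W(p; Δt) = ∫₀^{t_m} Φ(t_m, τ; Δt) diag(p) Φ(t_m, τ; Δt)ᵀ dτ`, integrated entrywise. -/
def gramian (A : Fin m → ℝ → Matrix (Fin n) (Fin n) ℝ) (Δt : Fin m → ℝ) (p : Fin n → ℝ) :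
    Matrix (Fin n) (Fin n) ℝ :=
  let T := switchTime Δt m
  let Φ := stateTransition (systemMatrix A Δt) T
  Matrix.of fun i j => ∫ τ in (0 : ℝ)..T, (Φ T τ * Matrix.diagonal p * (Φ T τ).transpose) i j

/-- The feasible set of both problems: `p` in the standard simplex with `W(p; Δt) ≻ O`. -/
def feasible (A : Fin m → ℝ → Matrix (Fin n) (Fin n) ℝ) (Δt : Fin m → ℝ) : Set (Fin n → ℝ) :=
  {p | p ∈ stdSimplex ℝ (Fin n) ∧ (gramian A Δt p).PosDef}

/-- `p` is an optimal solution of the volumetric problem: minimise `-log det W(p; Δt)`. -/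
def IsVolumetricOptimal (A : Fin m → ℝ → Matrix (Fin n) (Fin n) ℝ) (Δt : Fin m → ℝ)
    (p : Fin n → ℝ) : Prop :=
  p ∈ feasible A Δt ∧ IsMinOn (fun q => -Real.log (gramian A Δt q).det) (feasible A Δt) p

/-- `p` is an optimal solution of the average energy problem: minimise `tr (W(p; Δt)⁻¹)`. -/
def IsAverageEnergyOptimal (A : Fin m → ℝ → Matrix (Fin n) (Fin n) ℝ) (Δt : Fin m → ℝ)
    (p : Fin n → ℝ) : Prop :=
  p ∈ feasible A Δt ∧ IsMinOn (fun q => ((gramian A Δt q)⁻¹).trace) (feasible A Δt) p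

/-- The admissible `Δt` for which the volumetric problem has a unique optimal solution. -/
def uniqueVolumetric (s : Fin m → ℝ) (A : Fin m → ℝ → Matrix (Fin n) (Fin n) ℝ) :
    Set (Fin m → ℝ) :=
  {Δt | Δt ∈ admissible s ∧ ∃! p, IsVolumetricOptimal A Δt p}

/-- The admissible `Δt` for which the average energy problem has a unique optimal solution. -/
def uniqueAverageEnergy (s : Fin m → ℝ) (A : Fin m → ℝ → Matrix (Fin n) (Fin n) ℝ) :
    Set (Fin m → ℝ) :=
  {Δt | Δt ∈ admissible s ∧ ∃! p, IsAverageEnergyOptimal A Δt p}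

/-- `S` contains a subset of `D` that is open in `D` (for the subspace topology) and dense in `D`. -/
def ContainsDenseOpenSubset (D S : Set (Fin m → ℝ)) : Prop :=
  ∃ U ⊆ S, (∃ O, IsOpen O ∧ U = D ∩ O) ∧ D ⊆ closure U

end LTV

end

/-! The Gramian is linear in the weights: `W(p; Δt) = ∑ i, p i • W i`, where `W i` is the Gramian of
the `i`-th unit vector. If the `W i` are linearly independent, then `p ↦ W(p)` is injective, and
strict convexity of `-log det` and of `tr (·)⁻¹` on positive definite matrices leaves at most one
minimiser (`eq_of_isMinOn_of_midpoint_lt`). Existence comes from compactness of the simplex, because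
uniform weights are feasible once the total time is positive (`existsUnique_optimal`).

Linear independence is tested through diagonals only: it suffices that the determinant of the array
`(W i) j j` is nonzero (`diagonalDet`). On the open box of durations this determinant is real
analytic. Indeed each piece has a fundamental solution `X k` with inverse `Y k`, analytic because
the coefficients are. Cutting the Gramian integral at the switching times then expresses it through
finitely many analytic functions of a single duration (`integral_path_eq_gramianSum`,
`analyticAt_gramianSum`).

The determinant is not identically zero. For durations `ε s` with `ε → 0` all transition matrices
tend to the identity, so `W i / ε` tends to `(∑ s k) • diagonal (Pi.single i 1)`, and the rescaled
determinant tends to `(∑ s k) ^ n > 0` (`exists_diagonalDet_ne_zero`). An analytic function that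
does not vanish identically on a box has a null zero set (`volume_zeros_box`). Its nonvanishing set
is open and, since nonempty open sets have positive measure, dense; the boundary of `D` is null as
well (`dense_conull_of_analytic`). -/

namespace LTV

/-! ### Global existence for linear differential equations -/

section LinearODE

variable {E : Type*} [NormedAddCommGroup E] [NormedSpace ℝ E]

/-- The terms of the Volterra series solving `y' = L(t) y`, `y(0) = y₀`. -/
noncomputable def volterraTerm (L : ℝ → E →L[ℝ] E) (y₀ : E) : ℕ → ℝ → E
  | 0 => fun _ => y₀
  | n + 1 => fun t => ∫ s in (0 : ℝ)..t, L s (volterraTerm L y₀ n s)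

theorem continuous_volterraTerm [CompleteSpace E] {L : ℝ → E →L[ℝ] E} (hL : Continuous L) (y₀ : E)
    (n : ℕ) : Continuous (volterraTerm L y₀ n) := by
  induction n with
  | zero => exact continuous_const
  | succ n ih =>
    exact intervalIntegral.continuous_primitive
      (fun a b => (hL.clm_apply ih).intervalIntegrable a b) 0

theorem hasDerivAt_volterraTerm_succ [CompleteSpace E] {L : ℝ → E →L[ℝ] E} (hL : Continuous L)
    (y₀ : E) (n : ℕ) (t : ℝ) :
    HasDerivAt (volterraTerm L y₀ (n + 1)) (L t (volterraTerm L y₀ n t)) t :=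
  (hL.clm_apply (continuous_volterraTerm hL y₀ n)).integral_hasStrictDerivAt 0 t |>.hasDerivAt

/-- Each iteration costs a factor `K` and integrates `|s| ^ n`, which supplies the next factor of
the factorial. The Volterra series is thus dominated by an exponential series. -/
theorem norm_volterraTerm_le {L : ℝ → E →L[ℝ] E} {K : ℝ} (hK : ∀ t, ‖L t‖ ≤ K) (y₀ : E)
    (n : ℕ) (t : ℝ) : ‖volterraTerm L y₀ n t‖ ≤ (K * |t|) ^ n / n.factorial * ‖y₀‖ := by
  have hK0 : 0 ≤ K := (norm_nonneg _).trans (hK 0)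
  induction n generalizing t with
  | zero => simp [volterraTerm]
  | succ n ih =>
    have hbound : ∀ s : ℝ, ‖L s (volterraTerm L y₀ n s)‖ ≤
        K ^ (n + 1) / n.factorial * ‖y₀‖ * |s - 0| ^ n := fun s => by
      calc _ ≤ ‖L s‖ * ‖volterraTerm L y₀ n s‖ := (L s).le_opNorm _
        _ ≤ K * ((K * |s|) ^ n / n.factorial * ‖y₀‖) :=
          mul_le_mul (hK s) (ih s) (norm_nonneg _) hK0
        _ = _ := by rw [mul_pow, sub_zero]; ring
    calc ‖volterraTerm L y₀ (n + 1) t‖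
        ≤ ∫ s in uIoc 0 t, K ^ (n + 1) / n.factorial * ‖y₀‖ * |s - 0| ^ n := by
          rw [volterraTerm, intervalIntegral.norm_intervalIntegral_eq]
          refine norm_integral_le_of_norm_le ?_ (Eventually.of_forall hbound)
          exact (Continuous.intervalIntegrable (by fun_prop) 0 t).def'
      _ = _ := by
          rw [integral_const_mul, integral_pow_abs_sub_uIoc, sub_zero, Nat.factorial_succ, mul_pow]
          push_cast
          field_simp

/-- Global solvability of linear differential equations with continuous bounded coefficients. -/
theorem exists_linear_ode_solution [CompleteSpace E] {L : ℝ → E →L[ℝ] E} (hL : Continuous L)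
    {K : ℝ} (hK : ∀ t, ‖L t‖ ≤ K) (y₀ : E) :
    ∃ y : ℝ → E, y 0 = y₀ ∧ ∀ t, HasDerivAt y (L t (y t)) t := by
  have hK0 : 0 ≤ K := (norm_nonneg _).trans (hK 0)
  have hsum : ∀ t, Summable fun n => volterraTerm L y₀ n t := fun t =>
    .of_norm_bounded ((Real.summable_pow_div_factorial (K * |t|)).mul_right ‖y₀‖)
      (fun n => norm_volterraTerm_le hK y₀ n t)
  refine ⟨fun t => ∑' n, volterraTerm L y₀ n t, ?_, fun t => ?_⟩
  · beta_reduce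
    rw [tsum_eq_single 0 fun n hn => ?_]
    · rfl
    · obtain ⟨k, rfl⟩ := Nat.exists_eq_succ_of_ne_zero hn
      simp [volterraTerm]
  · set S : ℝ := |t| + 1
    -- The constant zeroth term is split off: differentiating term `n + 1` gives `L` applied to term
    -- `n`, so the differentiated tail sums to `L` of the full series.
    have hderiv : ∀ n : ℕ, ∀ s ∈ Ioo (-S) S, HasDerivAt (fun u => volterraTerm L y₀ (n + 1) u)
        (L s (volterraTerm L y₀ n s)) s := fun n s _ => hasDerivAt_volterraTerm_succ hL y₀ n s
    have hb : ∀ n : ℕ, ∀ s ∈ Ioo (-S) S, ‖L s (volterraTerm L y₀ n s)‖ ≤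
        K * ((K * S) ^ n / n.factorial * ‖y₀‖) := fun n s hs => by
      have hs' : |s| ≤ S := (abs_lt.2 hs).le
      refine ((L s).le_opNorm _).trans (mul_le_mul (hK s)
        ((norm_volterraTerm_le hK y₀ n s).trans ?_) (norm_nonneg _) hK0)
      gcongr
    have hS : t ∈ Ioo (-S) S := abs_lt.1 (lt_add_one |t|)
    have key := hasDerivAt_tsum_of_isPreconnected
      (((Real.summable_pow_div_factorial (K * S)).mul_right ‖y₀‖).mul_left K) isOpen_Ioo
      isPreconnected_Ioo hderiv hb hS ((summable_nat_add_iff 1).2 (hsum t)) hS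
    rw [← (L t).map_tsum (hsum t)] at key
    have hfun : (fun t => ∑' n, volterraTerm L y₀ n t) =
        fun t => y₀ + ∑' n, volterraTerm L y₀ (n + 1) t := by
      funext t
      rw [(hsum t).tsum_eq_zero_add, volterraTerm]
    have key' := key.const_add y₀
    rwa [← hfun] at key'

end LinearODE

/-! ### Analyticity of solutions of linear equations -/

section Analytic

variable {R : Type*} [NormedRing R] [NormedAlgebra ℝ R]

/-- The Taylor coefficients of the solution of `X' = (∑ aₙ tⁿ) X`, `X(0) = 1`. -/
noncomputable def linearODECoeff (a : ℕ → R) : ℕ → R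
  | 0 => 1
  | n + 1 => ((n : ℝ) + 1)⁻¹ • ∑ k : Fin (n + 1), a (n - k) * linearODECoeff a k

theorem succ_smul_linearODECoeff (a : ℕ → R) (n : ℕ) :
    ((n : ℝ) + 1) • linearODECoeff a (n + 1) =
      ∑ k ∈ Finset.range (n + 1), a (n - k) * linearODECoeff a k := by
  rw [linearODECoeff, smul_smul, mul_inv_cancel₀ (by positivity), one_smul,
    Fin.sum_univ_eq_sum_range fun k => a (n - k) * linearODECoeff a k]

/-- The recursion sums `n + 1` products, each at most `M ^ (n + 1)`, and then divides by `n + 1`.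
Using one `M` both as constant and as ratio makes the induction close. -/
theorem norm_linearODECoeff_le [NormOneClass R] {a : ℕ → R} {M : ℝ} (hM : 0 ≤ M)
    (ha : ∀ n, ‖a n‖ ≤ M * M ^ n) (n : ℕ) : ‖linearODECoeff a n‖ ≤ M ^ n := by
  induction n using Nat.strong_induction_on with
  | _ n ih =>
    cases n with
    | zero => simp [linearODECoeff]
    | succ n =>
      have hpos : (0 : ℝ) < n + 1 := by positivity
      have h : ‖((n : ℝ) + 1) • linearODECoeff a (n + 1)‖ ≤ ((n : ℝ) + 1) * M ^ (n + 1) := by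
        rw [succ_smul_linearODECoeff]
        calc _ ≤ ∑ k ∈ Finset.range (n + 1), M ^ (n + 1) := by
              refine norm_sum_le_of_le _ fun k hk => ?_
              have hk' := Finset.mem_range.1 hk
              calc _ ≤ ‖a (n - k)‖ * ‖linearODECoeff a k‖ := norm_mul_le _ _
                _ ≤ (M * M ^ (n - k)) * M ^ k :=
                  mul_le_mul (ha _) (ih k hk') (norm_nonneg _) (by positivity)
                _ = M ^ (n + 1) := by
                  rw [mul_assoc, ← pow_add, Nat.sub_add_cancel (by omega), pow_succ']
          _ = _ := by simp
      rw [norm_smul, Real.norm_of_nonneg hpos.le] at h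
      exact le_of_mul_le_mul_left h hpos

/-- A linear differential equation with analytic coefficients has an analytic fundamental
solution. -/
theorem exists_analyticAt_fundamental [CompleteSpace R] [NormOneClass R] {A : ℝ → R} {t₀ : ℝ}
    (hA : AnalyticAt ℝ A t₀) :
    ∃ X : ℝ → R, AnalyticAt ℝ X t₀ ∧ X t₀ = 1 ∧ ∀ᶠ t in 𝓝 t₀, HasDerivAt X (A t * X t) t := by
  obtain ⟨p, hp⟩ := hA
  obtain ⟨C, r, hC, hr, hCr⟩ := p.le_mul_pow_of_radius_pos hp.radius_pos
  set M : ℝ := max C r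
  have hM : 0 < M := lt_max_of_lt_left hC
  have ha : ∀ n, ‖p.coeff n‖ ≤ M * M ^ n := fun n => by
    rw [← FormalMultilinearSeries.norm_apply_eq_norm_coef]
    refine (hCr n).trans ?_
    gcongr
    exacts [le_max_left _ _, le_max_right _ _]
  set x := linearODECoeff p.coeff
  have hx : ∀ n, ‖x n‖ ≤ M ^ n := norm_linearODECoeff_le hM.le ha
  -- On this radius both power series are dominated by geometric series of ratio `1 / 2`.
  set ρ : ℝ := (2 * M)⁻¹
  have hρ : 0 < ρ := by positivity
  have hρM : ρ * M = 1 / 2 := by simp only [ρ]; field_simp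
  have hgeom : ∀ t ∈ Ioo (-ρ) ρ, ∀ n : ℕ, |t| ^ n * M ^ n ≤ (1 / 2) ^ n := fun t ht n => by
    rw [← mul_pow, ← hρM]
    have : |t| ≤ ρ := (abs_lt.2 ht).le
    gcongr
  have hnx : ∀ t ∈ Ioo (-ρ) ρ, Summable fun n => ‖t ^ n • x n‖ := fun t ht =>
    .of_nonneg_of_le (fun _ => norm_nonneg _) (fun n => by
      rw [norm_smul, norm_pow, Real.norm_eq_abs]
      exact (mul_le_mul_of_nonneg_left (hx n) (by positivity)).trans (hgeom t ht n))
      (summable_geometric_of_lt_one (by norm_num) (by norm_num : (1 / 2 : ℝ) < 1))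
  have hna : ∀ t ∈ Ioo (-ρ) ρ, Summable fun n => ‖t ^ n • p.coeff n‖ := fun t ht =>
    .of_nonneg_of_le (fun _ => norm_nonneg _) (fun n => by
      rw [norm_smul, norm_pow, Real.norm_eq_abs]
      calc _ ≤ |t| ^ n * (M * M ^ n) := mul_le_mul_of_nonneg_left (ha n) (by positivity)
        _ = M * (|t| ^ n * M ^ n) := by ring
        _ ≤ M * (1 / 2) ^ n := mul_le_mul_of_nonneg_left (hgeom t ht n) hM.le)
      ((summable_geometric_of_lt_one (by norm_num) (by norm_num : (1 / 2 : ℝ) < 1)).mul_left M)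
  have hnear : ∀ᶠ t in 𝓝 (0 : ℝ), t ∈ Ioo (-ρ) ρ := Ioo_mem_nhds (by linarith) hρ
  have hderiv : ∀ t ∈ Ioo (-ρ) ρ, HasDerivAt (fun t => ∑' n, t ^ n • x n)
      ((∑' n, t ^ n • p.coeff n) * ∑' n, t ^ n • x n) t := fun t ht => by
    have key := hasDerivAt_tsum_of_isPreconnected (α := ℕ) (u := fun n : ℕ => ((n : ℝ) + 1) * (1 / 2) ^ n * M)
      (g := fun (n : ℕ) t => t ^ (n + 1) • x (n + 1))
      (g' := fun (n : ℕ) t => t ^ n • (((n : ℝ) + 1) • x (n + 1))) (t := Ioo (-ρ) ρ) (y := t) (y₀ := t)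
      ?_ isOpen_Ioo isPreconnected_Ioo ?_ ?_ ht ?_ ht
    · have hfun : ∀ s ∈ Ioo (-ρ) ρ,
          ∑' n, s ^ n • x n = x 0 + ∑' n, s ^ (n + 1) • x (n + 1) := fun s hs => by
        rw [(hnx s hs).of_norm.tsum_eq_zero_add, pow_zero, one_smul]
      -- The Cauchy product turns the recursion for the coefficients into the differential equation.
      have hprod : (∑' n, t ^ n • p.coeff n) * ∑' n, t ^ n • x n =
          ∑' n : ℕ, t ^ n • (((n : ℝ) + 1) • x (n + 1)) := by
        rw [tsum_mul_tsum_eq_tsum_sum_antidiagonal_of_summable_norm (hna t ht) (hnx t ht)]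
        refine tsum_congr fun n => ?_
        rw [succ_smul_linearODECoeff, Finset.Nat.sum_antidiagonal_eq_sum_range_succ_mk,
          ← Finset.sum_range_reflect, Finset.smul_sum]
        refine Finset.sum_congr rfl fun k hk => ?_
        have hk' := Finset.mem_range.1 hk
        have e : n - (n + 1 - 1 - k) = k := by omega
        simp only [e]
        rw [smul_mul_smul_comm, ← pow_add]
        congr 2
        omega
      rw [hprod]
      refine (key.const_add (x 0)).congr_of_eventuallyEq ?_
      filter_upwards [isOpen_Ioo.mem_nhds ht] with s hs using hfun s hs
    · refine Summable.mul_right M ?_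
      have h1 := summable_pow_mul_geometric_of_norm_lt_one 1 (r := (1 / 2 : ℝ)) (by norm_num)
      have h2 := summable_geometric_of_lt_one (by norm_num) (by norm_num : (1 / 2 : ℝ) < 1)
      simpa [add_mul] using h1.add h2
    · intro n s _
      have := (hasDerivAt_pow (n + 1) s).smul_const (x (n + 1))
      convert this using 1
      rw [smul_smul]
      push_cast
      rw [mul_comm]
    · intro n s hs
      rw [norm_smul, norm_smul, norm_pow, Real.norm_eq_abs, Real.norm_of_nonneg (by positivity)]
      calc _ ≤ |s| ^ n * (((n : ℝ) + 1) * M ^ (n + 1)) := by gcongr; exact hx _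
        _ = ((n : ℝ) + 1) * (|s| ^ n * M ^ n) * M := by ring
        _ ≤ _ := by gcongr; exact hgeom s hs n
    · exact (summable_nat_add_iff 1).2 (hnx t ht).of_norm
  have hsub : Tendsto (fun t => t - t₀) (𝓝 t₀) (𝓝 0) := by
    have : Continuous fun t : ℝ => t - t₀ := by fun_prop
    simpa using this.tendsto t₀
  refine ⟨fun t => ∑' n, (t - t₀) ^ n • x n, ?_, ?_, ?_⟩
  · refine ⟨fun n => ContinuousMultilinearMap.mkPiRing ℝ (Fin n) (x n), ?_⟩
    refine hasFPowerSeriesAt_iff.2 ?_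
    filter_upwards [hnear] with t ht
    simpa [FormalMultilinearSeries.coeff] using (hnx t ht).of_norm.hasSum
  · beta_reduce
    rw [tsum_eq_single 0 fun n hn => by simp [hn]]
    simp [x, linearODECoeff]
  · filter_upwards [hsub.eventually hnear, hasFPowerSeriesAt_iff'.1 hp] with t ht hAt
    rw [← hAt.tsum_eq]
    simpa using HasDerivAt.comp_sub_const t t₀ (hderiv _ ht)

end Analytic

section

variable {E : Type*} [NormedAddCommGroup E] [NormedSpace ℝ E] [CompleteSpace E]

/-- Solutions of a linear differential equation with analytic coefficients are analytic. -/
theorem analyticAt_of_linear_ode {L : ℝ → E →L[ℝ] E} {y : ℝ → E} {t₀ : ℝ}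
    (hL : AnalyticAt ℝ L t₀) (hy : ∀ᶠ t in 𝓝 t₀, HasDerivAt y (L t (y t)) t) :
    AnalyticAt ℝ y t₀ := by
  -- The identity operator has norm one only when `E` is nontrivial.
  cases subsingleton_or_nontrivial E
  · exact (analyticAt_const (v := (0 : E))).congr (Eventually.of_forall fun _ => Subsingleton.elim _ _)
  obtain ⟨X, hX, hX0, hX'⟩ := exists_analyticAt_fundamental hL
  have hXy : AnalyticAt ℝ (fun t => X t (y t₀)) t₀ :=
    ((ContinuousLinearMap.apply ℝ E (y t₀)).analyticAt _).comp hX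
  refine hXy.congr ?_
  have hlip : ∀ᶠ t in 𝓝 t₀, LipschitzOnWith (‖L t₀‖₊ + 1) (fun z => L t z) univ := by
    have : ∀ᶠ t in 𝓝 t₀, ‖L t‖₊ < ‖L t₀‖₊ + 1 :=
      hL.continuousAt.nnnorm.eventually_lt_const (by simp)
    filter_upwards [this] with t ht
    exact ((L t).lipschitz.weaken ht.le).lipschitzOnWith
  refine ODE_solution_unique_of_eventually (v := fun t z => L t z) (s := fun _ => univ) hlip
    ?_ (hy.mono fun t ht => ⟨ht, trivial⟩) (by simp [hX0])
  filter_upwards [hX'] with t ht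
  refine ⟨?_, trivial⟩
  simpa using ht.clm_apply (hasDerivAt_const t (y t₀))

/-- A function with analytic derivative is analytic. -/
theorem analyticAt_of_hasDerivAt {f g : ℝ → ℝ} {t₀ : ℝ} (hg : AnalyticAt ℝ g t₀)
    (hf : ∀ᶠ t in 𝓝 t₀, HasDerivAt f (g t) t) : AnalyticAt ℝ f t₀ := by
  -- With `N (a, b) = (b, 0)`, the equation `f' = g` becomes the homogeneous linear system `(f, 1)'
  -- = g • N (f, 1)`.
  let N : ℝ × ℝ →L[ℝ] ℝ × ℝ := (ContinuousLinearMap.inl ℝ ℝ ℝ).comp (ContinuousLinearMap.snd ℝ ℝ ℝ)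
  have h : AnalyticAt ℝ (fun t => (f t, (1 : ℝ))) t₀ := by
    refine analyticAt_of_linear_ode (L := fun t => g t • N) (hg.smul analyticAt_const) ?_
    filter_upwards [hf] with t ht
    simpa [N] using ht.prodMk (hasDerivAt_const t (1 : ℝ))
  exact (ContinuousLinearMap.fst ℝ ℝ ℝ).analyticAt _ |>.comp h

end

/-! ### Null zero sets of analytic functions -/

/-- The zero set of a nonzero analytic function on an open interval is null. -/
theorem volume_zeros_Ioo {f : ℝ → ℝ} {a b x : ℝ} (hf : AnalyticOnNhd ℝ f (Ioo a b))
    (hx : x ∈ Ioo a b) (hfx : f x ≠ 0) : volume {t ∈ Ioo a b | f t = 0} = 0 := by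
  have h := ae_restrict_le_codiscreteWithin (μ := volume) (measurableSet_Ioo (a := a) (b := b))
    (hf.preimage_zero_mem_codiscreteWithin hfx hx (isConnected_Ioo (hx.1.trans hx.2)))
  rw [mem_ae_iff, Measure.restrict_apply' measurableSet_Ioo] at h
  refine measure_mono_null (fun t ht => ?_) h
  exact ⟨by simpa using ht.2, ht.1⟩

theorem analyticAt_insertNth_right {m : ℕ} (t : ℝ) (y : Fin m → ℝ) :
    AnalyticAt ℝ (fun y : Fin m → ℝ => (Fin.insertNth 0 t y : Fin (m + 1) → ℝ)) y := by
  refine analyticAt_pi_iff.2 fun i => ?_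
  refine Fin.cases ?_ (fun j => ?_) i
  · simpa using analyticAt_const
  · simpa using! (ContinuousLinearMap.proj (R := ℝ) (φ := fun _ : Fin m => ℝ) j).analyticAt y

theorem analyticAt_insertNth_left {m : ℕ} (t : ℝ) (y : Fin m → ℝ) :
    AnalyticAt ℝ (fun t : ℝ => (Fin.insertNth 0 t y : Fin (m + 1) → ℝ)) t := by
  refine analyticAt_pi_iff.2 fun i => ?_
  refine Fin.cases ?_ (fun j => ?_) i
  · simpa using! (analyticAt_id (𝕜 := ℝ) (z := t))
  · simpa using analyticAt_const

/-- The zero set of a nonzero analytic function on an open box is null. -/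
theorem volume_zeros_box {m : ℕ} {f : (Fin m → ℝ) → ℝ} {a b x : Fin m → ℝ}
    (hf : AnalyticOnNhd ℝ f (univ.pi fun k => Ioo (a k) (b k)))
    (hx : x ∈ univ.pi fun k => Ioo (a k) (b k)) (hfx : f x ≠ 0) :
    volume {t ∈ univ.pi fun k => Ioo (a k) (b k) | f t = 0} = 0 := by
  induction m with
  | zero =>
    convert measure_empty (μ := volume)
    ext t
    simp [Subsingleton.elim t x, hfx]
  | succ m ih =>
    set B := univ.pi fun k => Ioo (a k) (b k)
    have hBo : IsOpen B := isOpen_set_pi finite_univ fun _ _ => isOpen_Ioo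
    have hmem : ∀ (t : ℝ) (y : Fin m → ℝ), (Fin.insertNth 0 t y : Fin (m + 1) → ℝ) ∈ B ↔
        t ∈ Ioo (a 0) (b 0) ∧ y ∈ univ.pi fun k => Ioo (a (Fin.succ k)) (b (Fin.succ k)) := by
      intro t y
      simp [B, Set.mem_pi, Fin.forall_fin_succ]
    have hmeas : MeasurableSet {t ∈ B | f t = 0} := by
      have h1 : {t ∈ B | f t = 0} = B \ (B ∩ f ⁻¹' {0}ᶜ) := by
        ext t; simp
      rw [h1]
      exact hBo.measurableSet.diff
        (hf.continuousOn.isOpen_inter_preimage hBo isOpen_compl_singleton).measurableSet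
    have hmp := (volume_preserving_piFinSuccAbove (fun _ : Fin (m + 1) => ℝ) 0).symm
    rw [← hmp.measure_preimage hmeas.nullMeasurableSet, Measure.volume_eq_prod,
      Measure.measure_prod_null (hmp.measurable hmeas)]
    obtain ⟨x₀, x', rfl⟩ : ∃ (x₀ : ℝ) (x' : Fin m → ℝ), x = Fin.insertNth 0 x₀ x' :=
      ⟨x 0, fun k => x k.succ, by ext i; refine Fin.cases ?_ (fun j => ?_) i <;> simp⟩
    obtain ⟨hx0, hx'⟩ := (hmem _ _).1 hx
    -- On the line through `x` in the first coordinate, almost every `t` has `f (t, x') ≠ 0`. For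
    -- such `t` the slice at `t` contains a nonzero point, so the induction hypothesis makes its
    -- zero set null, and Fubini concludes.
    have hnull := volume_zeros_Ioo (f := fun t => f (Fin.insertNth 0 t x')) (fun t ht =>
      (hf _ ((hmem _ _).2 ⟨ht, hx'⟩)).comp_of_eq (analyticAt_insertNth_left t x') rfl) hx0 hfx
    have hae : ∀ᵐ t : ℝ, t ∉ {t ∈ Ioo (a 0) (b 0) | f (Fin.insertNth 0 t x') = 0} :=
      measure_eq_zero_iff_ae_notMem.1 hnull
    filter_upwards [hae] with t ht
    by_cases htI : t ∈ Ioo (a 0) (b 0)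
    · refine measure_mono_null ?_ (ih (f := fun y => f (Fin.insertNth 0 t y))
        (a := fun k => a (Fin.succ k)) (b := fun k => b (Fin.succ k)) (x := x')
        (fun y hy => (hf _ ((hmem _ _).2 ⟨htI, hy⟩)).comp_of_eq (analyticAt_insertNth_right t y) rfl)
        hx' fun h0 => ht ⟨htI, h0⟩)
      rintro y ⟨hyB, hy0⟩
      exact ⟨((hmem t y).1 hyB).2, hy0⟩
    · refine measure_mono_null (fun y hy => ?_) measure_empty
      exact htI ((hmem t y).1 hy.1).1

/-! ### Strict convexity, existence and uniqueness of minimisers -/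

section Optimisation

open Matrix

variable {n : ℕ}

theorem exists_eq_mul_diagonal_mul_transpose {P : Matrix (Fin n) (Fin n) ℝ} (hP : P.IsHermitian) :
    ∃ U : Matrix (Fin n) (Fin n) ℝ, U * Uᵀ = 1 ∧ P = U * diagonal hP.eigenvalues * Uᵀ := by
  refine ⟨hP.eigenvectorUnitary, ?_, ?_⟩
  · simpa [star_eq_conjTranspose] using Unitary.coe_mul_star_self hP.eigenvectorUnitary
  · simpa [Unitary.conjStarAlgAut_apply, star_eq_conjTranspose, Function.comp_def] using
      hP.spectral_theorem

theorem isUnit_det_of_mul_transpose_eq_one {U : Matrix (Fin n) (Fin n) ℝ} (h : U * Uᵀ = 1) :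
    IsUnit U.det :=
  (isUnit_iff_isUnit_det U).1 (IsUnit.of_mul_eq_one _ h)

/-- Simultaneous diagonalisation of two positive definite matrices by a congruence. -/
theorem exists_simultaneous_diagonalization {P Q : Matrix (Fin n) (Fin n) ℝ} (hP : P.PosDef)
    (hQ : Q.PosDef) : ∃ (S : Matrix (Fin n) (Fin n) ℝ) (d : Fin n → ℝ), IsUnit S.det ∧
      (∀ i, 0 < d i) ∧ P = S * Sᵀ ∧ Q = S * diagonal d * Sᵀ := by
  obtain ⟨U, hU, hPU⟩ := exists_eq_mul_diagonal_mul_transpose hP.isHermitian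
  set e := hP.isHermitian.eigenvalues
  have he : ∀ i, 0 < e i := hP.eigenvalues_pos
  set C := U * diagonal fun i => √(e i)
  have hCdet : IsUnit C.det := by
    rw [det_mul, det_diagonal]
    exact (isUnit_det_of_mul_transpose_eq_one hU).mul
      (Finset.prod_ne_zero_iff.2 fun i _ => (Real.sqrt_pos.2 (he i)).ne').isUnit
  have hCP : P = C * Cᵀ := by
    rw [hPU, transpose_mul, diagonal_transpose, Matrix.mul_assoc U (diagonal _) (_ * _),
      ← Matrix.mul_assoc (diagonal _) (diagonal _), diagonal_mul_diagonal, ← Matrix.mul_assoc]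
    simp only [Real.mul_self_sqrt (he _).le]
  have hCinv : IsUnit C⁻¹ := by
    rw [isUnit_nonsing_inv_iff, isUnit_iff_isUnit_det]; exact hCdet
  have hQ' : (C⁻¹ * Q * C⁻¹ᵀ).PosDef := by
    have h := (IsUnit.posDef_star_right_conjugate_iff (x := Q) hCinv).2 hQ
    simpa [star_eq_conjTranspose] using h
  obtain ⟨V, hV, hQV⟩ := exists_eq_mul_diagonal_mul_transpose hQ'.isHermitian
  refine ⟨C * V, _, ?_, hQ'.eigenvalues_pos, ?_, ?_⟩
  · rw [det_mul]
    exact hCdet.mul (isUnit_det_of_mul_transpose_eq_one hV)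
  · rw [transpose_mul, Matrix.mul_assoc, ← Matrix.mul_assoc V, hV, Matrix.one_mul, hCP]
  · have hCC : C * C⁻¹ = 1 := mul_nonsing_inv C hCdet
    have hCC' : C⁻¹ᵀ * Cᵀ = 1 := by rw [← transpose_mul, hCC, transpose_one]
    calc Q = (C * C⁻¹) * Q * (C⁻¹ᵀ * Cᵀ) := by rw [hCC, hCC', Matrix.one_mul, Matrix.mul_one]
      _ = C * (C⁻¹ * Q * C⁻¹ᵀ) * Cᵀ := by simp only [Matrix.mul_assoc]
      _ = C * (V * diagonal hQ'.isHermitian.eigenvalues * Vᵀ) * Cᵀ :=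
        congrArg (C * · * Cᵀ) hQV
      _ = _ := by rw [transpose_mul C V]; simp only [Matrix.mul_assoc]

theorem midpoint_mul_diagonal_mul_transpose (S : Matrix (Fin n) (Fin n) ℝ) (d : Fin n → ℝ) :
    (1 / 2 : ℝ) • (S * Sᵀ + S * diagonal d * Sᵀ) = S * diagonal (fun i => (1 + d i) / 2) * Sᵀ := by
  have : diagonal (fun i => (1 + d i) / 2) = (1 / 2 : ℝ) • (1 + diagonal d) := by
    ext i j
    rcases eq_or_ne i j with rfl | h
    · simp; ring
    · simp [h]
  rw [this, Matrix.mul_smul, Matrix.smul_mul, Matrix.mul_add, Matrix.mul_one, Matrix.add_mul]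

/-- A congruence reduces the pair to `1` and `diagonal d`, where the claim is the product of the
inequalities `d i ≤ ((1 + d i) / 2) ^ 2`, strict wherever `d i ≠ 1`. -/
theorem neg_log_det_midpoint_lt {P Q : Matrix (Fin n) (Fin n) ℝ} (hP : P.PosDef) (hQ : Q.PosDef)
    (hPQ : P ≠ Q) : -Real.log ((1 / 2 : ℝ) • (P + Q)).det <
      (-Real.log P.det + -Real.log Q.det) / 2 := by
  have hPd := hP.det_pos
  have hQd := hQ.det_pos
  have hMd := ((hP.add hQ).smul (by norm_num : (0 : ℝ) < 1 / 2)).det_pos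
  suffices h : P.det * Q.det < ((1 / 2 : ℝ) • (P + Q)).det ^ 2 by
    have := Real.log_lt_log (mul_pos hPd hQd) h
    rw [Real.log_mul hPd.ne' hQd.ne', Real.log_pow] at this
    push_cast at this
    linarith
  obtain ⟨S, d, hS, hd, rfl, rfl⟩ := exists_simultaneous_diagonalization hP hQ
  rw [midpoint_mul_diagonal_mul_transpose]
  simp only [det_mul, det_transpose, det_diagonal]
  have hne : ∃ i, d i ≠ 1 := by
    by_contra! h
    refine hPQ ?_
    rw [show d = fun _ => 1 from funext h, diagonal_one, Matrix.mul_one]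
  obtain ⟨i, hi⟩ := hne
  have hprod : ∏ i, d i < ∏ i, ((1 + d i) / 2) ^ 2 := by
    refine Finset.prod_lt_prod (fun i _ => hd i)
      (fun i _ => by nlinarith [sq_nonneg (1 - d i)]) ⟨i, Finset.mem_univ i, ?_⟩
    have : 0 < (1 - d i) ^ 2 := by
      have : 1 - d i ≠ 0 := sub_ne_zero.2 (Ne.symm hi)
      positivity
    nlinarith
  rw [Finset.prod_pow] at hprod
  -- Both sides carry the congruence factor `S.det ^ 2` twice.
  have hs : 0 < S.det ^ 4 := by
    have := hS.ne_zero
    positivity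
  nlinarith [mul_lt_mul_of_pos_left hprod hs]

theorem inv_mul_diagonal_mul_transpose {S : Matrix (Fin n) (Fin n) ℝ} (hS : IsUnit S.det)
    {d : Fin n → ℝ} (hd : ∀ i, 0 < d i) :
    (S * diagonal d * Sᵀ)⁻¹ = S⁻¹ᵀ * diagonal (fun i => (d i)⁻¹) * S⁻¹ := by
  refine inv_eq_right_inv ?_
  have h1 : Sᵀ * S⁻¹ᵀ = 1 := by rw [← transpose_mul, nonsing_inv_mul S hS, transpose_one]
  calc _ = S * (diagonal d * (Sᵀ * S⁻¹ᵀ) * diagonal (fun i => (d i)⁻¹)) * S⁻¹ := by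
        simp only [Matrix.mul_assoc]
    _ = 1 := by
        rw [h1, Matrix.mul_one, diagonal_mul_diagonal]
        simp only [mul_inv_cancel₀ (hd _).ne', diagonal_one, Matrix.mul_one, mul_nonsing_inv S hS]

theorem trace_transpose_mul_diagonal_mul (R : Matrix (Fin n) (Fin n) ℝ) (c : Fin n → ℝ) :
    (Rᵀ * diagonal c * R).trace = ∑ i, c i * (R * Rᵀ) i i := by
  rw [Matrix.mul_assoc, trace_mul_comm, Matrix.mul_assoc, trace]
  simp [diagonal_mul]

/-- After simultaneous diagonalisation the trace of the inverse is `∑ i, c i / d i` with weights `c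
i = (S⁻¹ * S⁻¹ᵀ) i i > 0`, so strict convexity of `x ↦ x⁻¹` applies termwise. -/
theorem trace_inv_midpoint_lt {P Q : Matrix (Fin n) (Fin n) ℝ} (hP : P.PosDef) (hQ : Q.PosDef)
    (hPQ : P ≠ Q) : (((1 / 2 : ℝ) • (P + Q))⁻¹).trace < ((P⁻¹).trace + (Q⁻¹).trace) / 2 := by
  obtain ⟨S, d, hS, hd, rfl, rfl⟩ := exists_simultaneous_diagonalization hP hQ
  have hne : ∃ i, d i ≠ 1 := by
    by_contra! h
    refine hPQ ?_
    rw [show d = fun _ => 1 from funext h, diagonal_one, Matrix.mul_one]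
  obtain ⟨i, hi⟩ := hne
  have h1 : S * Sᵀ = S * Matrix.diagonal (fun _ => 1) * Sᵀ := by rw [diagonal_one, Matrix.mul_one]
  rw [midpoint_mul_diagonal_mul_transpose, h1, inv_mul_diagonal_mul_transpose hS hd,
    inv_mul_diagonal_mul_transpose hS fun i => by have := hd i; positivity,
    inv_mul_diagonal_mul_transpose hS fun _ => one_pos]
  simp only [trace_transpose_mul_diagonal_mul]
  rw [← Finset.sum_add_distrib, Finset.sum_div]
  have hdiag : ∀ i, 0 < (S⁻¹ * S⁻¹ᵀ) i i := fun i => by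
    have : (S⁻¹ * S⁻¹ᵀ).PosDef := by
      have h := PosDef.mul_conjTranspose_self S⁻¹
        (vecMul_injective_of_isUnit (by
          rw [isUnit_nonsing_inv_iff, isUnit_iff_isUnit_det]; exact hS))
      simpa using h
    exact this.diag_pos
  have hkey : ∀ x : ℝ, 0 < x → (1⁻¹ + x⁻¹) / 2 - ((1 + x) / 2)⁻¹ = (1 - x) ^ 2 / (2 * x * (1 + x)) :=
    fun x hx => by field_simp; ring
  refine Finset.sum_lt_sum (fun j _ => ?_) ⟨i, Finset.mem_univ i, ?_⟩
  · rw [← add_mul, mul_div_right_comm]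
    refine mul_le_mul_of_nonneg_right ?_ (hdiag j).le
    have hx := hd j
    have : 0 ≤ (1 - d j) ^ 2 / (2 * d j * (1 + d j)) := by positivity
    linarith [hkey (d j) hx]
  · rw [← add_mul, mul_div_right_comm]
    refine mul_lt_mul_of_pos_right ?_ (hdiag i)
    have hx := hd i
    have h2 : 1 - d i ≠ 0 := sub_ne_zero.2 (Ne.symm hi)
    have : 0 < (1 - d i) ^ 2 / (2 * d i * (1 + d i)) := by positivity
    linarith [hkey (d i) hx]

/-- Each nonnegative eigenvalue is at most the trace. Applied to an inverse Gramian, this turns an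
energy bound into a lower bound for the determinant of the Gramian. -/
theorem det_le_trace_pow {P : Matrix (Fin n) (Fin n) ℝ} (hP : P.PosSemidef) :
    P.det ≤ P.trace ^ n := by
  have h0 := hP.eigenvalues_nonneg
  have hdet : P.det = ∏ i, hP.1.eigenvalues i := by simpa using hP.1.det_eq_prod_eigenvalues
  have htr : P.trace = ∑ i, hP.1.eigenvalues i := by simpa using hP.1.trace_eq_sum_eigenvalues
  rw [hdet, htr]
  calc ∏ i, hP.1.eigenvalues i ≤ ∏ _i : Fin n, ∑ j, hP.1.eigenvalues j :=
        Finset.prod_le_prod (fun i _ => h0 i)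
          fun i _ => Finset.single_le_sum (fun j _ => h0 j) (Finset.mem_univ i)
    _ = _ := by simp

/-- Minimisers of a strictly midpoint-convex function of `∑ pᵢ Wᵢ` are unique, if the `Wᵢ` are
linearly independent. -/
theorem eq_of_isMinOn_of_midpoint_lt {W : Fin n → Matrix (Fin n) (Fin n) ℝ}
    (hinj : Function.Injective fun p : Fin n → ℝ => ∑ i, p i • W i)
    {φ : Matrix (Fin n) (Fin n) ℝ → ℝ}
    (hφ : ∀ P Q : Matrix (Fin n) (Fin n) ℝ, P.PosDef → Q.PosDef → P ≠ Q →
      φ ((1 / 2 : ℝ) • (P + Q)) < (φ P + φ Q) / 2)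
    {p q : Fin n → ℝ}
    (hp : p ∈ {p | p ∈ stdSimplex ℝ (Fin n) ∧ (∑ i, p i • W i).PosDef})
    (hq : q ∈ {p | p ∈ stdSimplex ℝ (Fin n) ∧ (∑ i, p i • W i).PosDef})
    (hpm : IsMinOn (fun p : Fin n → ℝ => φ (∑ i, p i • W i))
      {p | p ∈ stdSimplex ℝ (Fin n) ∧ (∑ i, p i • W i).PosDef} p)
    (hqm : IsMinOn (fun p : Fin n → ℝ => φ (∑ i, p i • W i))
      {p | p ∈ stdSimplex ℝ (Fin n) ∧ (∑ i, p i • W i).PosDef} q) : p = q := by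
  by_contra hpq
  have hr : ∑ i, ((1 / 2 : ℝ) • (p + q)) i • W i =
      (1 / 2 : ℝ) • (∑ i, p i • W i + ∑ i, q i • W i) := by
    simp only [Pi.smul_apply, Pi.add_apply, smul_assoc, add_smul, Finset.smul_sum,
      Finset.sum_add_distrib, smul_add]
  have hrmem : (1 / 2 : ℝ) • (p + q) ∈
      {p | p ∈ stdSimplex ℝ (Fin n) ∧ (∑ i, p i • W i).PosDef} := by
    refine ⟨?_, ?_⟩
    · rw [smul_add]
      exact convex_stdSimplex ℝ (Fin n) hp.1 hq.1 (by norm_num) (by norm_num) (by norm_num)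
    · rw [hr]
      exact (hp.2.add hq.2).smul (by norm_num)
  have h1 := hφ _ _ hp.2 hq.2 (hinj.ne hpq)
  have h2 : φ (∑ i, p i • W i) ≤ _ := hpm hrmem
  have h3 : φ (∑ i, q i • W i) ≤ _ := hqm hrmem
  beta_reduce at h2 h3
  rw [hr] at h2 h3
  linarith

variable {W : Fin n → Matrix (Fin n) (Fin n) ℝ}

theorem continuous_sum_smul (W : Fin n → Matrix (Fin n) (Fin n) ℝ) :
    Continuous fun p : Fin n → ℝ => ∑ i, p i • W i := by fun_prop

/-- The determinant is continuous on the whole compact simplex, unlike its logarithm. Its maximiser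
beats `p₀`, hence has positive determinant and is feasible. -/
theorem existsUnique_volumetric (hinj : Function.Injective fun p : Fin n → ℝ => ∑ i, p i • W i)
    (hpsd : ∀ p ∈ stdSimplex ℝ (Fin n), (∑ i, p i • W i).PosSemidef)
    {p₀ : Fin n → ℝ} (hp₀ : p₀ ∈ stdSimplex ℝ (Fin n)) (hpos : (∑ i, p₀ i • W i).PosDef) :
    ∃! p, p ∈ {p | p ∈ stdSimplex ℝ (Fin n) ∧ (∑ i, p i • W i).PosDef} ∧
      IsMinOn (fun p : Fin n → ℝ => -Real.log (∑ i, p i • W i).det)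
        {p | p ∈ stdSimplex ℝ (Fin n) ∧ (∑ i, p i • W i).PosDef} p := by
  obtain ⟨p, hp, hmax⟩ := (isCompact_stdSimplex ℝ (Fin n)).exists_isMaxOn ⟨p₀, hp₀⟩
    (f := fun p : Fin n → ℝ => (∑ i, p i • W i).det) (continuous_sum_smul W).matrix_det.continuousOn
  have hppos : (∑ i, p i • W i).PosDef :=
    (hpsd p hp).posDef_iff_det_ne_zero.2 (hpos.det_pos.trans_le (hmax hp₀)).ne'
  refine existsUnique_of_exists_of_unique ⟨p, ⟨hp, hppos⟩, fun q hq => ?_⟩ fun p q hp hq =>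
    eq_of_isMinOn_of_midpoint_lt (φ := fun M => -Real.log M.det) hinj (fun P Q => neg_log_det_midpoint_lt) hp.1 hq.1 hp.2 hq.2
  exact neg_le_neg (Real.log_le_log hq.2.det_pos (hmax hq.1))

/-- The feasible set need not be closed, so the minimum is first taken over the compact part of the
simplex where the determinant is at least `(c ^ n)⁻¹`. Feasible points outside it cost more than
`c`, hence more than `p₀`. -/
theorem existsUnique_averageEnergy
    (hinj : Function.Injective fun p : Fin n → ℝ => ∑ i, p i • W i)
    (hpsd : ∀ p ∈ stdSimplex ℝ (Fin n), (∑ i, p i • W i).PosSemidef)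
    {p₀ : Fin n → ℝ} (hp₀ : p₀ ∈ stdSimplex ℝ (Fin n)) (hpos : (∑ i, p₀ i • W i).PosDef) :
    ∃! p, p ∈ {p | p ∈ stdSimplex ℝ (Fin n) ∧ (∑ i, p i • W i).PosDef} ∧
      IsMinOn (fun p : Fin n → ℝ => ((∑ i, p i • W i)⁻¹).trace)
        {p | p ∈ stdSimplex ℝ (Fin n) ∧ (∑ i, p i • W i).PosDef} p := by
  set G : (Fin n → ℝ) → Matrix (Fin n) (Fin n) ℝ := fun p => ∑ i, p i • W i
  have hG : Continuous G := continuous_sum_smul W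
  set c := max ((G p₀)⁻¹).trace 1
  have hc : 0 < c := lt_max_of_lt_right one_pos
  -- a bound on the objective keeps the determinant away from zero
  have hdet : ∀ q, (G q).PosDef → ((G q)⁻¹).trace ≤ c → (c ^ n)⁻¹ ≤ (G q).det := fun q hq hqc => by
    have h1 := (det_le_trace_pow hq.inv.posSemidef).trans
      (pow_le_pow_left₀ hq.inv.posSemidef.trace_nonneg hqc n)
    rw [det_nonsing_inv, Ring.inverse_eq_inv'] at h1
    exact inv_le_of_inv_le₀ hq.det_pos h1
  set K := stdSimplex ℝ (Fin n) ∩ {p | (c ^ n)⁻¹ ≤ (G p).det}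
  have hK : IsCompact K := (isCompact_stdSimplex ℝ (Fin n)).inter_right
    (isClosed_le continuous_const hG.matrix_det)
  have hKpos : ∀ p ∈ K, (G p).PosDef := fun p hp =>
    (hpsd p hp.1).posDef_iff_det_ne_zero.2 ((by positivity : 0 < (c ^ n)⁻¹).trans_le hp.2).ne'
  have hcont : ContinuousOn (fun p => ((G p)⁻¹).trace) K := by
    simp only [inv_def, trace_smul, Ring.inverse_eq_inv', smul_eq_mul]
    exact (hG.matrix_det.continuousOn.inv₀ fun p hp => (hKpos p hp).det_pos.ne').mul
      hG.matrix_adjugate.matrix_trace.continuousOn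
  have hp₀K : p₀ ∈ K := ⟨hp₀, hdet p₀ hpos (le_max_left _ _)⟩
  obtain ⟨p, hp, hmin⟩ := hK.exists_isMinOn ⟨p₀, hp₀K⟩ hcont
  refine existsUnique_of_exists_of_unique ⟨p, ⟨hp.1, hKpos p hp⟩, fun q hq => ?_⟩ fun p q hp hq =>
    eq_of_isMinOn_of_midpoint_lt (φ := fun M => (M⁻¹).trace) hinj
      (fun P Q => trace_inv_midpoint_lt) hp.1 hq.1 hp.2 hq.2
  by_cases hqc : ((G q)⁻¹).trace ≤ c
  · exact hmin ⟨hq.1, hdet q hq.2 hqc⟩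
  · exact (hmin hp₀K).trans ((le_max_left _ _).trans (not_le.1 hqc).le)

end Optimisation

/-! ### Fundamental solutions of a single piece -/

/-- Freezing the coefficients at their endpoint values outside `[0, s]` makes them continuous and
bounded on `ℝ`, so a global solution exists. Inside `(0, s)` the clamp is the identity and
analyticity survives. -/
theorem exists_solution_clamped {E ι : Type*} [NormedAddCommGroup E] [NormedSpace ℝ E]
    [CompleteSpace E] [Fintype ι] (B : ι → E →L[ℝ] E) {a : ι → ℝ → ℝ} {s : ℝ} (hs : 0 < s)
    (hc : ∀ i, ContinuousOn (a i) (Icc 0 s)) (ha : ∀ i, AnalyticOnNhd ℝ (a i) (Ioo 0 s)) (y₀ : E) :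
    ∃ y : ℝ → E, y 0 = y₀ ∧ (∀ t, HasDerivAt y (∑ i, a i (max 0 (min t s)) • B i (y t)) t) ∧
      ∀ t ∈ Ioo 0 s, AnalyticAt ℝ y t := by
  have hmem : ∀ t : ℝ, max 0 (min t s) ∈ Icc 0 s := fun t =>
    ⟨le_max_left _ _, max_le hs.le (min_le_right _ _)⟩
  set L : ℝ → E →L[ℝ] E := fun t => ∑ i, a i t • B i
  have hLc : ContinuousOn L (Icc 0 s) :=
    continuousOn_finsetSum _ fun i _ => (hc i).smul continuousOn_const
  obtain ⟨K, hK⟩ := isCompact_Icc.exists_bound_of_continuousOn hLc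
  obtain ⟨y, hy0, hy⟩ := exists_linear_ode_solution (L := fun t => L (max 0 (min t s)))
    (hLc.comp_continuous (by fun_prop) hmem) (fun t => hK _ (hmem t)) y₀
  refine ⟨y, hy0, fun t => by simpa [L] using hy t, fun t ht => ?_⟩
  refine analyticAt_of_linear_ode (L := L) ?_ ?_
  · exact Finset.analyticAt_fun_sum _ fun i _ => (ha i t ht).smul analyticAt_const
  · filter_upwards [isOpen_Ioo.mem_nhds ht] with u hu
    have := hy u
    rwa [min_eq_left hu.2.le, max_eq_right hu.1.le] at this

variable {n : ℕ}

/-- `X` and `Y` are the fundamental solution of `ẋ = F x` on `ℝ`, normalised at `0`, and its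
inverse. -/
structure IsFundamentalPair (F X Y : ℝ → Matrix (Fin n) (Fin n) ℝ) : Prop where
  left_zero : X 0 = 1
  right_zero : Y 0 = 1
  hasDerivAt_left : ∀ t i j, HasDerivAt (fun t => X t i j) ((F t * X t) i j) t
  hasDerivAt_right : ∀ t i j, HasDerivAt (fun t => Y t i j) (-(Y t * F t) i j) t

theorem hasDerivWithinAt_mul_apply {X X' Y Y' : ℝ → Matrix (Fin n) (Fin n) ℝ} {u : Set ℝ} {t : ℝ}
    (hX : ∀ i j, HasDerivWithinAt (fun t => X t i j) (X' t i j) u t)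
    (hY : ∀ i j, HasDerivWithinAt (fun t => Y t i j) (Y' t i j) u t) (i j : Fin n) :
    HasDerivWithinAt (fun t => (X t * Y t) i j) ((X' t * Y t + X t * Y' t) i j) u t := by
  simp only [Matrix.mul_apply, Matrix.add_apply, ← Finset.sum_add_distrib]
  exact HasDerivWithinAt.fun_sum fun k _ => (hX i k).mul (hY k j)

namespace IsFundamentalPair

variable {F X Y : ℝ → Matrix (Fin n) (Fin n) ℝ}

/-- The derivative of `Y * X` is `-Y F X + Y F X = 0`. -/
theorem right_mul_left (h : IsFundamentalPair F X Y) (t : ℝ) : Y t * X t = 1 := by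
  ext i j
  have hd : ∀ u, HasDerivAt (fun u => (Y u * X u) i j) 0 u := fun u => by
    have := hasDerivWithinAt_mul_apply (X' := fun t => -(Y t * F t)) (Y' := fun t => F t * X t)
      (fun i j => (h.hasDerivAt_right u i j).hasDerivWithinAt (s := univ))
      (fun i j => (h.hasDerivAt_left u i j).hasDerivWithinAt) i j
    rw [hasDerivWithinAt_univ] at this
    simpa [Matrix.mul_assoc] using this
  have := is_const_of_deriv_eq_zero (fun u => (hd u).differentiableAt) (fun u => (hd u).deriv) t 0
  simpa [h.left_zero, h.right_zero] using this

theorem continuous_left (h : IsFundamentalPair F X Y) : Continuous X :=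
  continuous_matrix fun i j =>
    continuous_iff_continuousAt.2 fun t => (h.hasDerivAt_left t i j).continuousAt

theorem continuous_right (h : IsFundamentalPair F X Y) : Continuous Y :=
  continuous_matrix fun i j =>
    continuous_iff_continuousAt.2 fun t => (h.hasDerivAt_right t i j).continuousAt

end IsFundamentalPair

/-- Puts multiplication by a varying matrix into the form of scalar entries times fixed operators
that `exists_solution_clamped` takes. -/
theorem sum_smul_single_mul (M N : Matrix (Fin n) (Fin n) ℝ) :
    ∑ q : Fin n × Fin n, M q.1 q.2 • (Matrix.single q.1 q.2 (1 : ℝ) * N) = M * N := by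
  conv_rhs => rw [Matrix.matrix_eq_sum_single M]
  rw [Fintype.sum_prod_type, Finset.sum_mul]
  refine Finset.sum_congr rfl fun i _ => ?_
  rw [Finset.sum_mul]
  refine Finset.sum_congr rfl fun j _ => ?_
  rw [← smul_mul_assoc, Matrix.smul_single, smul_eq_mul, mul_one]

theorem sum_smul_mul_single (M N : Matrix (Fin n) (Fin n) ℝ) :
    ∑ q : Fin n × Fin n, M q.1 q.2 • (N * Matrix.single q.1 q.2 (1 : ℝ)) = N * M := by
  conv_rhs => rw [Matrix.matrix_eq_sum_single M]
  rw [Fintype.sum_prod_type, Finset.mul_sum]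
  refine Finset.sum_congr rfl fun i _ => ?_
  rw [Finset.mul_sum]
  refine Finset.sum_congr rfl fun j _ => ?_
  rw [← mul_smul_comm, Matrix.smul_single, smul_eq_mul, mul_one]

/-- The inverse is obtained as the solution of the adjoint equation `Y' = -Y A`, so its analyticity
comes from the same source as that of `X`. -/
theorem exists_isFundamentalPair {A : ℝ → Matrix (Fin n) (Fin n) ℝ} {s : ℝ} (hs : 0 < s)
    (hc : ∀ i j, ContinuousOn (fun t => A t i j) (Icc 0 s))
    (ha : ∀ i j, AnalyticOnNhd ℝ (fun t => A t i j) (Ioo 0 s)) :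
    ∃ X Y : ℝ → Matrix (Fin n) (Fin n) ℝ,
      IsFundamentalPair (fun t => A (max 0 (min t s))) X Y ∧
      (∀ i j, ∀ t ∈ Ioo 0 s, AnalyticAt ℝ (fun t => X t i j) t) ∧
      ∀ i j, ∀ t ∈ Ioo 0 s, AnalyticAt ℝ (fun t => Y t i j) t := by
  let l : Matrix (Fin n) (Fin n) ℝ → (Fin n → Fin n → ℝ) →L[ℝ] (Fin n → Fin n → ℝ) := fun M =>
    LinearMap.toContinuousLinearMap (LinearMap.mulLeft ℝ M : Matrix (Fin n) (Fin n) ℝ →ₗ[ℝ] _)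
  let r : Matrix (Fin n) (Fin n) ℝ → (Fin n → Fin n → ℝ) →L[ℝ] (Fin n → Fin n → ℝ) := fun M =>
    LinearMap.toContinuousLinearMap (LinearMap.mulRight ℝ M : Matrix (Fin n) (Fin n) ℝ →ₗ[ℝ] _)
  obtain ⟨X, hX0, hX, hXa⟩ := exists_solution_clamped
    (fun q : Fin n × Fin n => l (Matrix.single q.1 q.2 1)) hs (a := fun q t => A t q.1 q.2)
    (fun q => hc _ _) (fun q => ha _ _) (1 : Matrix (Fin n) (Fin n) ℝ)
  obtain ⟨Y, hY0, hY, hYa⟩ := exists_solution_clamped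
    (fun q : Fin n × Fin n => -r (Matrix.single q.1 q.2 1)) hs (a := fun q t => A t q.1 q.2)
    (fun q => hc _ _) (fun q => ha _ _) (1 : Matrix (Fin n) (Fin n) ℝ)
  refine ⟨X, Y, ⟨hX0, hY0, fun t i j => ?_, fun t i j => ?_⟩, fun i j t ht => ?_,
    fun i j t ht => ?_⟩
  · have h := hasDerivAt_pi.1 (hasDerivAt_pi.1 (hX t) i) j
    have e := sum_smul_single_mul (A (max 0 (min t s))) (X t)
    rw [← e]
    exact h
  · have h := hasDerivAt_pi.1 (hasDerivAt_pi.1 (hY t) i) j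
    have e := sum_smul_mul_single (A (max 0 (min t s))) (Y t)
    rw [← Matrix.neg_apply, ← e, ← Finset.sum_neg_distrib]
    simp only [neg_apply, smul_neg] at h
    exact h
  · exact analyticAt_pi_iff.1 (analyticAt_pi_iff.1 (hXa t ht) i) j
  · exact analyticAt_pi_iff.1 (analyticAt_pi_iff.1 (hYa t ht) i) j

/-! ### Gluing the pieces into the state transition matrix -/

/-- The sum of the first `k` durations. -/
def partialTime (δ : ℕ → ℝ) (k : ℕ) : ℝ := ∑ l ∈ Finset.range k, δ l

/-- The flow `X_{k-1}(δ_{k-1}) ⋯ X_0(δ_0)` over the first `k` pieces. -/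
def flowLeft (X : ℕ → ℝ → Matrix (Fin n) (Fin n) ℝ) (δ : ℕ → ℝ) : ℕ → Matrix (Fin n) (Fin n) ℝ
  | 0 => 1
  | k + 1 => X k (δ k) * flowLeft X δ k

/-- The product `Y_0(δ_0) ⋯ Y_{k-1}(δ_{k-1})`. -/
def flowRight (Y : ℕ → ℝ → Matrix (Fin n) (Fin n) ℝ) (δ : ℕ → ℝ) : ℕ → Matrix (Fin n) (Fin n) ℝ
  | 0 => 1
  | k + 1 => flowRight Y δ k * Y k (δ k)

/-- The time spent in piece `k` before time `t`. -/
noncomputable def elapsed (δ : ℕ → ℝ) (k : ℕ) (t : ℝ) : ℝ := max 0 (min (t - partialTime δ k) (δ k))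

theorem continuous_elapsed (δ : ℕ → ℝ) (k : ℕ) : Continuous (elapsed δ k) := by
  unfold elapsed; fun_prop

theorem partialTime_zero (δ : ℕ → ℝ) : partialTime δ 0 = 0 := by simp [partialTime]

theorem partialTime_succ (δ : ℕ → ℝ) (k : ℕ) : partialTime δ (k + 1) = partialTime δ k + δ k :=
  Finset.sum_range_succ _ _

theorem partialTime_mono {δ : ℕ → ℝ} (hδ : ∀ k, 0 ≤ δ k) : Monotone (partialTime δ) :=
  monotone_nat_of_le_succ fun k => by rw [partialTime_succ]; linarith [hδ k]

theorem elapsed_of_le {δ : ℕ → ℝ} {k : ℕ} {t : ℝ} (h : t ≤ partialTime δ k) :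
    elapsed δ k t = 0 :=
  max_eq_left ((min_le_left _ _).trans (by linarith))

theorem elapsed_of_ge {δ : ℕ → ℝ} (hδ : ∀ k, 0 ≤ δ k) {k : ℕ} {t : ℝ}
    (h : partialTime δ (k + 1) ≤ t) : elapsed δ k t = δ k := by
  rw [partialTime_succ] at h
  rw [elapsed, min_eq_right (by linarith), max_eq_right (hδ k)]

theorem elapsed_of_mem {δ : ℕ → ℝ} {k : ℕ} {t : ℝ}
    (h : t ∈ Icc (partialTime δ k) (partialTime δ (k + 1))) :
    elapsed δ k t = t - partialTime δ k := by
  rw [partialTime_succ] at h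
  rw [elapsed, min_eq_left (by linarith [h.2]), max_eq_right (by linarith [h.1])]

/-- The flow of the pieced-together system from `0` to `t`, over the first `k` pieces. -/
noncomputable def pathLeft (X : ℕ → ℝ → Matrix (Fin n) (Fin n) ℝ) (δ : ℕ → ℝ) (k : ℕ) (t : ℝ) :
    Matrix (Fin n) (Fin n) ℝ :=
  flowLeft X (fun l => elapsed δ l t) k

/-- The inverse of `pathLeft`. -/
noncomputable def pathRight (Y : ℕ → ℝ → Matrix (Fin n) (Fin n) ℝ) (δ : ℕ → ℝ) (k : ℕ) (t : ℝ) :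
    Matrix (Fin n) (Fin n) ℝ :=
  flowRight Y (fun l => elapsed δ l t) k

theorem flowLeft_congr (X : ℕ → ℝ → Matrix (Fin n) (Fin n) ℝ) {δ δ' : ℕ → ℝ} {k : ℕ}
    (h : ∀ l < k, δ l = δ' l) : flowLeft X δ k = flowLeft X δ' k := by
  induction k with
  | zero => rfl
  | succ k ih =>
    rw [flowLeft, flowLeft, h k k.lt_succ_self, ih fun l hl => h l (hl.trans k.lt_succ_self)]

theorem flowRight_congr (Y : ℕ → ℝ → Matrix (Fin n) (Fin n) ℝ) {δ δ' : ℕ → ℝ} {k : ℕ}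
    (h : ∀ l < k, δ l = δ' l) : flowRight Y δ k = flowRight Y δ' k := by
  induction k with
  | zero => rfl
  | succ k ih =>
    rw [flowRight, flowRight, h k k.lt_succ_self, ih fun l hl => h l (hl.trans k.lt_succ_self)]

theorem flowLeft_of_zero {X : ℕ → ℝ → Matrix (Fin n) (Fin n) ℝ} (hX : ∀ k, X k 0 = 1)
    {δ : ℕ → ℝ} {k j : ℕ} (hkj : k ≤ j) (h : ∀ l, k ≤ l → δ l = 0) :
    flowLeft X δ j = flowLeft X δ k := by
  induction j, hkj using Nat.le_induction with
  | base => rfl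
  | succ j hj ih => rw [flowLeft, h j hj, hX, Matrix.one_mul, ih]

theorem flowRight_of_zero {Y : ℕ → ℝ → Matrix (Fin n) (Fin n) ℝ} (hY : ∀ k, Y k 0 = 1)
    {δ : ℕ → ℝ} {k j : ℕ} (hkj : k ≤ j) (h : ∀ l, k ≤ l → δ l = 0) :
    flowRight Y δ j = flowRight Y δ k := by
  induction j, hkj using Nat.le_induction with
  | base => rfl
  | succ j hj ih => rw [flowRight, h j hj, hY, Matrix.mul_one, ih]

theorem flowRight_mul_flowLeft {X Y : ℕ → ℝ → Matrix (Fin n) (Fin n) ℝ}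
    (h : ∀ k t, Y k t * X k t = 1) (δ : ℕ → ℝ) (k : ℕ) :
    flowRight Y δ k * flowLeft X δ k = 1 := by
  induction k with
  | zero => exact Matrix.one_mul 1
  | succ k ih =>
    rw [flowRight, flowLeft, Matrix.mul_assoc, ← Matrix.mul_assoc (Y k _), h, Matrix.one_mul, ih]

theorem continuous_flowLeft {α : Type*} [TopologicalSpace α]
    {X : ℕ → ℝ → Matrix (Fin n) (Fin n) ℝ} (hX : ∀ k, Continuous (X k)) {δ : α → ℕ → ℝ}
    (hδ : ∀ k, Continuous fun x => δ x k) (k : ℕ) : Continuous fun x => flowLeft X (δ x) k := by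
  induction k with
  | zero => exact continuous_const
  | succ k ih => exact ((hX k).comp (hδ k)).matrix_mul ih

theorem continuous_flowRight {α : Type*} [TopologicalSpace α]
    {Y : ℕ → ℝ → Matrix (Fin n) (Fin n) ℝ} (hY : ∀ k, Continuous (Y k)) {δ : α → ℕ → ℝ}
    (hδ : ∀ k, Continuous fun x => δ x k) (k : ℕ) : Continuous fun x => flowRight Y (δ x) k := by
  induction k with
  | zero => exact continuous_const
  | succ k ih => exact ih.matrix_mul ((hY k).comp (hδ k))

section Path

variable {X Y : ℕ → ℝ → Matrix (Fin n) (Fin n) ℝ} {δ : ℕ → ℝ} {m k : ℕ} {t : ℝ}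

/-- During piece `k` the earlier pieces have run their full duration, and the later ones have
elapsed time `0` and contribute the identity. Both endpoints are included, as the one-sided
derivatives at switching times require. -/
theorem pathLeft_of_mem (hX : ∀ k, X k 0 = 1) (hδ : ∀ k, 0 ≤ δ k) (hk : k < m)
    (h : t ∈ Icc (partialTime δ k) (partialTime δ (k + 1))) :
    pathLeft X δ m t = X k (t - partialTime δ k) * flowLeft X δ k := by
  rw [pathLeft, flowLeft_of_zero hX (Nat.succ_le_of_lt hk) fun l hl =>
    elapsed_of_le (h.2.trans (partialTime_mono hδ hl)), flowLeft, elapsed_of_mem h]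
  congr 1
  exact flowLeft_congr X fun l hl =>
    elapsed_of_ge hδ ((partialTime_mono hδ (Nat.succ_le_of_lt hl)).trans h.1)

theorem pathRight_of_mem (hY : ∀ k, Y k 0 = 1) (hδ : ∀ k, 0 ≤ δ k) (hk : k < m)
    (h : t ∈ Icc (partialTime δ k) (partialTime δ (k + 1))) :
    pathRight Y δ m t = flowRight Y δ k * Y k (t - partialTime δ k) := by
  rw [pathRight, flowRight_of_zero hY (Nat.succ_le_of_lt hk) fun l hl =>
    elapsed_of_le (h.2.trans (partialTime_mono hδ hl)), flowRight, elapsed_of_mem h]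
  congr 1
  exact flowRight_congr Y fun l hl =>
    elapsed_of_ge hδ ((partialTime_mono hδ (Nat.succ_le_of_lt hl)).trans h.1)

theorem pathLeft_partialTime (hδ : ∀ k, 0 ≤ δ k) :
    pathLeft X δ m (partialTime δ m) = flowLeft X δ m :=
  flowLeft_congr X fun _ hl => elapsed_of_ge hδ (partialTime_mono hδ (Nat.succ_le_of_lt hl))

/-- The piece ending at the first switching time beyond `t` works; pieces of zero duration are
skipped automatically. -/
theorem exists_mem_Ico_partialTime (h : t ∈ Ico 0 (partialTime δ m)) :
    ∃ k < m, t ∈ Ico (partialTime δ k) (partialTime δ (k + 1)) := by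
  classical
  have hex : ∃ j, t < partialTime δ j := ⟨m, h.2⟩
  obtain ⟨k, hk⟩ : ∃ k, Nat.find hex = k + 1 := Nat.exists_eq_succ_of_ne_zero fun h0 => by
    have := Nat.find_spec hex
    rw [h0, partialTime_zero] at this
    exact this.not_ge h.1
  refine ⟨k, ?_, not_lt.1 (Nat.find_min hex (by omega)), hk ▸ Nat.find_spec hex⟩
  have := Nat.find_min' hex h.2
  omega

theorem exists_mem_Ioc_partialTime (h : t ∈ Ioc 0 (partialTime δ m)) :
    ∃ k < m, t ∈ Ioc (partialTime δ k) (partialTime δ (k + 1)) := by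
  classical
  have hex : ∃ j, t ≤ partialTime δ j := ⟨m, h.2⟩
  obtain ⟨k, hk⟩ : ∃ k, Nat.find hex = k + 1 := Nat.exists_eq_succ_of_ne_zero fun h0 => by
    have := Nat.find_spec hex
    rw [h0, partialTime_zero] at this
    exact this.not_gt h.1
  refine ⟨k, ?_, not_le.1 (Nat.find_min hex (by omega)), hk ▸ Nat.find_spec hex⟩
  have := Nat.find_min' hex h.2
  omega

variable {F : ℕ → ℝ → Matrix (Fin n) (Fin n) ℝ} (hF : ∀ k, IsFundamentalPair (F k) (X k) (Y k))
include hF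

theorem hasDerivWithinAt_pathLeft (hδ : ∀ k, 0 ≤ δ k) (hk : k < m) {u : Set ℝ}
    (ht : t ∈ Icc (partialTime δ k) (partialTime δ (k + 1)))
    (hu : ∀ᶠ t' in 𝓝[u] t, t' ∈ Icc (partialTime δ k) (partialTime δ (k + 1))) (i j : Fin n) :
    HasDerivWithinAt (fun t => pathLeft X δ m t i j)
      ((F k (t - partialTime δ k) * pathLeft X δ m t) i j) u t := by
  have h0 : ∀ k, X k 0 = 1 := fun k => (hF k).left_zero
  have h := hasDerivWithinAt_mul_apply (X := fun t => X k (t - partialTime δ k))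
    (X' := fun t => F k (t - partialTime δ k) * X k (t - partialTime δ k))
    (Y := fun _ => flowLeft X δ k) (Y' := fun _ => 0) (u := u) (t := t)
    (fun i j => (((hF k).hasDerivAt_left _ i j).comp_sub_const t _).hasDerivWithinAt)
    (fun i j => hasDerivWithinAt_const _ _ _) i j
  rw [pathLeft_of_mem h0 hδ hk ht, ← Matrix.mul_assoc]
  rw [Matrix.mul_zero, add_zero] at h
  refine h.congr_of_eventuallyEq ?_ ?_
  · filter_upwards [hu] with t' ht'
    rw [pathLeft_of_mem h0 hδ hk ht']
  · rw [pathLeft_of_mem h0 hδ hk ht]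

theorem hasDerivWithinAt_pathRight (hδ : ∀ k, 0 ≤ δ k) (hk : k < m) {u : Set ℝ}
    (ht : t ∈ Icc (partialTime δ k) (partialTime δ (k + 1)))
    (hu : ∀ᶠ t' in 𝓝[u] t, t' ∈ Icc (partialTime δ k) (partialTime δ (k + 1))) (i j : Fin n) :
    HasDerivWithinAt (fun t => pathRight Y δ m t i j)
      ((-(pathRight Y δ m t * F k (t - partialTime δ k))) i j) u t := by
  have h0 : ∀ k, Y k 0 = 1 := fun k => (hF k).right_zero
  have h := hasDerivWithinAt_mul_apply (X := fun _ => flowRight Y δ k) (X' := fun _ => 0)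
    (Y := fun t => Y k (t - partialTime δ k))
    (Y' := fun t => -(Y k (t - partialTime δ k) * F k (t - partialTime δ k))) (u := u) (t := t)
    (fun i j => hasDerivWithinAt_const _ _ _)
    (fun i j => (((hF k).hasDerivAt_right _ i j).comp_sub_const t _).hasDerivWithinAt) i j
  rw [pathRight_of_mem h0 hδ hk ht, Matrix.mul_assoc, ← Matrix.mul_neg]
  rw [Matrix.zero_mul, zero_add] at h
  refine h.congr_of_eventuallyEq ?_ ?_
  · filter_upwards [hu] with t' ht'
    rw [pathRight_of_mem h0 hδ hk ht']
  · rw [pathRight_of_mem h0 hδ hk ht]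

theorem continuous_pathLeft : Continuous (pathLeft X δ m) :=
  continuous_flowLeft (fun k => (hF k).continuous_left) (fun k => continuous_elapsed δ k) m

theorem continuous_pathRight : Continuous (pathRight Y δ m) :=
  continuous_flowRight (fun k => (hF k).continuous_right) (fun k => continuous_elapsed δ k) m

theorem pathRight_mul_pathLeft : pathRight Y δ m t * pathLeft X δ m t = 1 :=
  flowRight_mul_flowLeft (fun k => (hF k).right_mul_left) _ m

theorem pathLeft_mul_pathRight : pathLeft X δ m t * pathRight Y δ m t = 1 :=
  mul_eq_one_comm.1 (pathRight_mul_pathLeft hF)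

variable {S : ℝ → Matrix (Fin n) (Fin n) ℝ}
  (hS : ∀ k < m, ∀ t ∈ Ico (partialTime δ k) (partialTime δ (k + 1)),
    S t = F k (t - partialTime δ k))
include hS

/-- Agreement of `S` with the pieces on half-open intervals is enough: right derivatives are taken
before the final time, and the left limit of `S` is read off just before `t`, where it equals the
continuous `F k`. -/
theorem isStateTransition_path (hFc : ∀ k, Continuous (F k)) (hδ : ∀ k, 0 ≤ δ k) :
    IsStateTransition S (partialTime δ m)
      (fun t τ => pathLeft X δ m t * pathRight Y δ m τ) where
  continuousOn := by
    have h1 := continuous_pathLeft hF (δ := δ) (m := m)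
    have h2 := continuous_pathRight hF (δ := δ) (m := m)
    exact ((h1.comp continuous_fst).matrix_mul (h2.comp continuous_snd)).continuousOn
  initial τ _ := pathLeft_mul_pathRight hF
  right_deriv τ _ t ht i j := by
    obtain ⟨k, hk, htk⟩ := exists_mem_Ico_partialTime ht
    have hu : ∀ᶠ t' in 𝓝[≥] t, t' ∈ Icc (partialTime δ k) (partialTime δ (k + 1)) := by
      filter_upwards [Icc_mem_nhdsGE htk.2] with t' ht' using ⟨htk.1.trans ht'.1, ht'.2⟩
    have h := hasDerivWithinAt_mul_apply
      (X' := fun t => F k (t - partialTime δ k) * pathLeft X δ m t)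
      (Y := fun _ => pathRight Y δ m τ) (Y' := fun _ => 0)
      (hasDerivWithinAt_pathLeft hF hδ hk (Ico_subset_Icc_self htk) hu)
      (fun i j => hasDerivWithinAt_const _ _ _) i j
    rw [hS k hk t htk, ← Matrix.mul_assoc]
    rwa [Matrix.mul_zero, add_zero] at h
  left_deriv τ _ t ht := by
    obtain ⟨k, hk, htk⟩ := exists_mem_Ioc_partialTime ht
    have hu : ∀ᶠ t' in 𝓝[≤] t, t' ∈ Icc (partialTime δ k) (partialTime δ (k + 1)) := by
      filter_upwards [Icc_mem_nhdsLE htk.1] with t' ht' using ⟨ht'.1, ht'.2.trans htk.2⟩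
    refine ⟨F k (t - partialTime δ k), ?_, fun i j => ?_⟩
    · have hc : Continuous fun t => F k (t - partialTime δ k) :=
        (hFc k).comp (continuous_sub_right _)
      refine (hc.continuousWithinAt (s := Iio t) (x := t)).tendsto.congr' ?_
      filter_upwards [Ioo_mem_nhdsLT htk.1] with t' ht'
      exact (hS k hk t' ⟨ht'.1.le, ht'.2.trans_le htk.2⟩).symm
    · have h := hasDerivWithinAt_mul_apply
        (X' := fun t => F k (t - partialTime δ k) * pathLeft X δ m t)
        (Y := fun _ => pathRight Y δ m τ) (Y' := fun _ => 0)
        (hasDerivWithinAt_pathLeft hF hδ hk (Ioc_subset_Icc_self htk) hu)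
        (fun i j => hasDerivWithinAt_const _ _ _) i j
      rw [← Matrix.mul_assoc]
      rwa [Matrix.mul_zero, add_zero] at h

/-- Uniqueness: `pathRight u * Φ u τ` is continuous with zero right derivative, hence constant in
`u`, and its value is read off at `u = τ`. This identifies the matrix selected by choice in
`stateTransition`. -/
theorem IsStateTransition.eq_path {Φ : ℝ → ℝ → Matrix (Fin n) (Fin n) ℝ}
    (hΦ : IsStateTransition S (partialTime δ m) Φ) (hδ : ∀ k, 0 ≤ δ k)
    {τ : ℝ} (ht : t ∈ Icc 0 (partialTime δ m)) (hτ : τ ∈ Icc 0 (partialTime δ m)) :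
    Φ t τ = pathLeft X δ m t * pathRight Y δ m τ := by
  have hconst : ∀ u ∈ Icc 0 (partialTime δ m),
      pathRight Y δ m u * Φ u τ = pathRight Y δ m 0 * Φ 0 τ := fun u hu => by
    ext i j
    have hc : ContinuousOn (fun u => (pathRight Y δ m u * Φ u τ)) (Icc 0 (partialTime δ m)) := by
      refine continuousOn_iff_continuous_domRestrict.2 ?_
      have h1 : Continuous ((Icc 0 (partialTime δ m)).domRestrict fun u => Φ u τ) :=
        continuousOn_iff_continuous_domRestrict.1 (hΦ.continuousOn.comp
          (f := fun u => (u, τ)) (by fun_prop) fun u hu => ⟨hu, hτ⟩)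
      exact ((continuous_pathRight hF).comp continuous_subtype_val).matrix_mul h1
    have hcij : ContinuousOn (fun u => (pathRight Y δ m u * Φ u τ) i j)
        (Icc 0 (partialTime δ m)) :=
      ((continuous_id.matrix_elem i j).comp_continuousOn hc :)
    refine constant_of_has_deriv_right_zero hcij (fun t ht => ?_) u hu
    obtain ⟨k, hk, htk⟩ := exists_mem_Ico_partialTime ht
    have hu : ∀ᶠ t' in 𝓝[≥] t, t' ∈ Icc (partialTime δ k) (partialTime δ (k + 1)) := by
      filter_upwards [Icc_mem_nhdsGE htk.2] with t' ht' using ⟨htk.1.trans ht'.1, ht'.2⟩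
    have h := hasDerivWithinAt_mul_apply
      (X' := fun t => -(pathRight Y δ m t * F k (t - partialTime δ k)))
      (Y' := fun t => S t * Φ t τ)
      (hasDerivWithinAt_pathRight hF hδ hk (Ico_subset_Icc_self htk) hu)
      (fun i j => hΦ.right_deriv τ hτ t ht i j) i j
    simpa [hS k hk t htk, Matrix.mul_assoc] using h
  have h1 : pathRight Y δ m t * Φ t τ = pathRight Y δ m τ := by
    rw [hconst t ht, ← hconst τ hτ, hΦ.initial τ hτ, Matrix.mul_one]
  rw [← h1, ← Matrix.mul_assoc, pathLeft_mul_pathRight hF, Matrix.one_mul]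

theorem stateTransition_eq_path (hFc : ∀ k, Continuous (F k)) (hδ : ∀ k, 0 ≤ δ k) {τ : ℝ}
    (ht : t ∈ Icc 0 (partialTime δ m)) (hτ : τ ∈ Icc 0 (partialTime δ m)) :
    stateTransition S (partialTime δ m) t τ = pathLeft X δ m t * pathRight Y δ m τ := by
  have hex : ∃ Φ, IsStateTransition S (partialTime δ m) Φ :=
    ⟨_, isStateTransition_path hF hS hFc hδ⟩
  rw [stateTransition, dif_pos hex]
  exact hex.choose_spec.eq_path hF hS hδ ht hτ

end Path

/-! ### The Gramian as a sum over pieces -/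

theorem continuous_mul_diagonal_mul_transpose {C : ℝ → Matrix (Fin n) (Fin n) ℝ} (hC : Continuous C)
    (p : Fin n → ℝ) : Continuous fun t => C t * Matrix.diagonal p * (C t).transpose :=
  (hC.matrix_mul continuous_const).matrix_mul hC.matrix_transpose

theorem integral_mul_mul_apply {M : ℝ → Matrix (Fin n) (Fin n) ℝ} (hM : Continuous M)
    (N R : Matrix (Fin n) (Fin n) ℝ) (a b : ℝ) (i j : Fin n) :
    ∫ t in a..b, (N * M t * R) i j =
      (N * Matrix.of (fun k l => ∫ t in a..b, M t k l) * R) i j := by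
  have hc : ∀ k l, Continuous fun t => M t k l := fun k l => hM.matrix_elem k l
  simp only [Matrix.mul_apply, Finset.sum_mul, Matrix.of_apply]
  rw [intervalIntegral.integral_finsetSum fun k _ =>
    Continuous.intervalIntegrable (by fun_prop) _ _]
  refine Finset.sum_congr rfl fun l _ => ?_
  rw [intervalIntegral.integral_finsetSum fun k _ =>
    Continuous.intervalIntegrable (by fun_prop) _ _]
  refine Finset.sum_congr rfl fun k _ => ?_
  rw [intervalIntegral.integral_mul_const, intervalIntegral.integral_const_mul]

section PosDef

open Matrix

variable {M : ℝ → Matrix (Fin n) (Fin n) ℝ} {T : ℝ}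

theorem dotProduct_integral_mulVec (hM : Continuous M) (x : Fin n → ℝ) :
    x ⬝ᵥ (of fun i j => ∫ t in (0 : ℝ)..T, M t i j) *ᵥ x = ∫ t in (0 : ℝ)..T, x ⬝ᵥ M t *ᵥ x := by
  have hc : ∀ k l, Continuous fun t => M t k l := fun k l => hM.matrix_elem k l
  simp only [dotProduct, mulVec, of_apply, Finset.mul_sum]
  rw [intervalIntegral.integral_finsetSum fun k _ =>
    Continuous.intervalIntegrable (by fun_prop) _ _]
  refine Finset.sum_congr rfl fun l _ => ?_
  rw [intervalIntegral.integral_finsetSum fun k _ =>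
    Continuous.intervalIntegrable (by fun_prop) _ _]
  refine Finset.sum_congr rfl fun k _ => ?_
  rw [intervalIntegral.integral_const_mul, intervalIntegral.integral_mul_const]

theorem isHermitian_integral (h : ∀ t, (M t).IsHermitian) :
    (of fun i j => ∫ t in (0 : ℝ)..T, M t i j : Matrix (Fin n) (Fin n) ℝ).IsHermitian := by
  ext i j
  simp only [conjTranspose_apply, of_apply, star_trivial]
  exact intervalIntegral.integral_congr fun t _ => by simpa using (h t).apply i j

theorem posSemidef_integral (hT : 0 ≤ T) (hM : Continuous M) (h : ∀ t, (M t).PosSemidef) :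
    (of fun i j => ∫ t in (0 : ℝ)..T, M t i j : Matrix (Fin n) (Fin n) ℝ).PosSemidef := by
  refine .of_dotProduct_mulVec_nonneg (isHermitian_integral fun t => (h t).isHermitian) fun x => ?_
  rw [star_trivial, dotProduct_integral_mulVec hM]
  exact intervalIntegral.integral_nonneg hT fun t _ => by
    simpa using (h t).dotProduct_mulVec_nonneg x

theorem posDef_integral (hT : 0 < T) (hM : Continuous M) (h : ∀ t, (M t).PosDef) :
    (of fun i j => ∫ t in (0 : ℝ)..T, M t i j : Matrix (Fin n) (Fin n) ℝ).PosDef := by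
  refine .of_dotProduct_mulVec_pos (isHermitian_integral fun t => (h t).isHermitian) fun x hx => ?_
  rw [star_trivial, dotProduct_integral_mulVec hM]
  have hc : Continuous fun t => x ⬝ᵥ M t *ᵥ x :=
    continuous_const.dotProduct (hM.matrix_mulVec continuous_const)
  exact intervalIntegral.intervalIntegral_pos_of_pos (hc.intervalIntegrable _ _)
    (fun t => by simpa using (h t).dotProduct_mulVec_pos hx) hT

end PosDef

/-- The matrix `∫₀ˣ Y(σ) diag(p) Y(σ)ᵀ dσ`. -/
noncomputable def pieceGramian (Y : ℝ → Matrix (Fin n) (Fin n) ℝ) (p : Fin n → ℝ) (x : ℝ) :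
    Matrix (Fin n) (Fin n) ℝ :=
  Matrix.of fun i j => ∫ σ in (0 : ℝ)..x, (Y σ * Matrix.diagonal p * (Y σ).transpose) i j

theorem pieceGramian_eq_sum {Y : ℝ → Matrix (Fin n) (Fin n) ℝ} (hY : Continuous Y) (p : Fin n → ℝ)
    (x : ℝ) : pieceGramian Y p x = ∑ i, p i • pieceGramian Y (Pi.single i 1) x := by
  ext a b
  have hc : ∀ q : Fin n → ℝ, Continuous fun σ =>
      (Y σ * Matrix.diagonal q * (Y σ).transpose) a b := fun q =>
    (continuous_mul_diagonal_mul_transpose hY q).matrix_elem a b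
  simp only [pieceGramian, Matrix.sum_apply, Matrix.smul_apply, Matrix.of_apply, smul_eq_mul,
    ← intervalIntegral.integral_const_mul]
  refine Eq.trans ?_ (intervalIntegral.integral_finsetSum (s := Finset.univ) (f := fun (i : Fin n) (σ : ℝ) =>
    p i * (Y σ * Matrix.diagonal (Pi.single i 1 : Fin n → ℝ) * (Y σ).transpose) a b) fun i _ =>
      (continuous_const.mul (hc _)).intervalIntegrable _ _)
  refine intervalIntegral.integral_congr fun σ _ => ?_
  have h : ∀ q : Fin n → ℝ, (Y σ * Matrix.diagonal q * (Y σ).transpose) a b =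
      ∑ j, Y σ a j * q j * Y σ b j := fun q => by
    rw [Matrix.mul_apply]
    simp only [Matrix.mul_diagonal, Matrix.transpose_apply]
  simp only [h]
  refine Finset.sum_congr rfl fun j _ => ?_
  simp only [Pi.single_apply, mul_ite, ite_mul, mul_one, mul_zero, zero_mul, Finset.sum_ite_eq',
    Finset.mem_univ, if_true]
  ring

theorem hasDerivAt_pieceGramian {Y : ℝ → Matrix (Fin n) (Fin n) ℝ} (hY : Continuous Y)
    (p : Fin n → ℝ) (x : ℝ) (i j : Fin n) :
    HasDerivAt (fun x => pieceGramian Y p x i j)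
      ((Y x * Matrix.diagonal p * (Y x).transpose) i j) x :=
  (((continuous_mul_diagonal_mul_transpose hY p).matrix_elem i j).integral_hasStrictDerivAt
    0 x).hasDerivAt

/-- The Gramian of the pieced-together system as a sum over the pieces. -/
noncomputable def gramianSum (X Y : ℕ → ℝ → Matrix (Fin n) (Fin n) ℝ) (m : ℕ) (p : Fin n → ℝ)
    (δ : ℕ → ℝ) : Matrix (Fin n) (Fin n) ℝ :=
  ∑ k ∈ Finset.range m, flowLeft X δ m * flowRight Y δ k * pieceGramian (Y k) p (δ k) *
    (flowLeft X δ m * flowRight Y δ k).transpose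

theorem gramianSum_eq_sum {X Y : ℕ → ℝ → Matrix (Fin n) (Fin n) ℝ} (hY : ∀ k, Continuous (Y k))
    (m : ℕ) (p : Fin n → ℝ) (δ : ℕ → ℝ) :
    gramianSum X Y m p δ = ∑ i, p i • gramianSum X Y m (Pi.single i 1) δ := by
  simp only [gramianSum, Finset.smul_sum]
  rw [Finset.sum_comm]
  refine Finset.sum_congr rfl fun k _ => ?_
  rw [pieceGramian_eq_sum (hY k) p, Finset.mul_sum, Finset.sum_mul]
  simp only [Matrix.mul_smul, Matrix.smul_mul]

section Gramian

variable {X Y F : ℕ → ℝ → Matrix (Fin n) (Fin n) ℝ} {δ : ℕ → ℝ} {m : ℕ}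
  (hF : ∀ k, IsFundamentalPair (F k) (X k) (Y k))
include hF

/-- The integral is cut at the switching times. On piece `k` the integrand depends on `τ` only
through `Y k (τ - partialTime δ k)`, so the remaining factors come out and a translation leaves an
integral over `[0, δ k]`. -/
theorem integral_path_eq_gramianSum (hδ : ∀ k, 0 ≤ δ k) (p : Fin n → ℝ) :
    (Matrix.of fun i j => ∫ τ in (0 : ℝ)..partialTime δ m,
      (flowLeft X δ m * pathRight Y δ m τ * Matrix.diagonal p *
        (flowLeft X δ m * pathRight Y δ m τ).transpose) i j) = gramianSum X Y m p δ := by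
  ext i j
  have hC : Continuous fun τ => flowLeft X δ m * pathRight Y δ m τ :=
    continuous_const.matrix_mul (continuous_pathRight hF)
  have hc := (continuous_mul_diagonal_mul_transpose hC p).matrix_elem i j
  rw [Matrix.of_apply, ← partialTime_zero δ, ← intervalIntegral.sum_integral_adjacent_intervals
    fun k _ => hc.intervalIntegrable _ _, gramianSum, Matrix.sum_apply]
  refine Finset.sum_congr rfl fun k hk => ?_
  have hk' := Finset.mem_range.1 hk
  set N := flowLeft X δ m * flowRight Y δ k
  have hle : partialTime δ k ≤ partialTime δ (k + 1) := partialTime_mono hδ k.le_succ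
  rw [pieceGramian, ← integral_mul_mul_apply
    (continuous_mul_diagonal_mul_transpose (hF k).continuous_right p)]
  have hsub := intervalIntegral.integral_comp_sub_right (a := partialTime δ k)
    (b := partialTime δ (k + 1)) (fun σ => (N * (Y k σ * Matrix.diagonal p * (Y k σ).transpose) *
      N.transpose) i j) (partialTime δ k)
  rw [sub_self, partialTime_succ, add_sub_cancel_left] at hsub
  rw [← hsub, ← partialTime_succ]
  refine intervalIntegral.integral_congr fun τ hτ => ?_
  rw [uIcc_of_le hle] at hτ
  rw [pathRight_of_mem (fun k => (hF k).right_zero) hδ hk' hτ, ← Matrix.mul_assoc]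
  simp only [N, Matrix.transpose_mul, Matrix.mul_assoc]

end Gramian

/-! ### Transfer to the given system and the uniqueness criterion -/

/-- A duration tuple, extended by zero to all of `ℕ`. -/
def extendZero {m : ℕ} (Δt : Fin m → ℝ) (k : ℕ) : ℝ := if h : k < m then Δt ⟨k, h⟩ else 0

theorem extendZero_of_lt {m : ℕ} (Δt : Fin m → ℝ) {k : ℕ} (h : k < m) :
    extendZero Δt k = Δt ⟨k, h⟩ := dif_pos h

theorem extendZero_nonneg {m : ℕ} {Δt : Fin m → ℝ} (h : ∀ k, 0 ≤ Δt k) (k : ℕ) :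
    0 ≤ extendZero Δt k := by
  unfold extendZero
  split_ifs
  exacts [h _, le_rfl]

theorem switchTime_eq_partialTime {m : ℕ} (Δt : Fin m → ℝ) {k : ℕ} (hk : k ≤ m) :
    switchTime Δt k = partialTime (extendZero Δt) k := by
  have h1 : switchTime Δt k = ∑ l : Fin m, if (l : ℕ) < k then extendZero Δt l else 0 :=
    Finset.sum_congr rfl fun l _ => by rw [extendZero_of_lt Δt l.2]
  rw [h1, Fin.sum_univ_eq_sum_range (fun l => if l < k then extendZero Δt l else 0) m,
    ← Finset.sum_filter, partialTime]
  congr 1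
  ext l
  simp only [Finset.mem_filter, Finset.mem_range]
  omega

theorem systemMatrix_of_mem {m : ℕ} (A : Fin m → ℝ → Matrix (Fin n) (Fin n) ℝ) {Δt : Fin m → ℝ}
    (hΔ : ∀ k, 0 ≤ Δt k) {k : ℕ} (hk : k < m) {t : ℝ}
    (ht : t ∈ Ico (partialTime (extendZero Δt) k) (partialTime (extendZero Δt) (k + 1))) :
    systemMatrix A Δt t = A ⟨k, hk⟩ (t - partialTime (extendZero Δt) k) := by
  have hmono := partialTime_mono (extendZero_nonneg hΔ)
  rw [systemMatrix, Finset.sum_eq_single ⟨k, hk⟩]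
  · simp only
    rw [switchTime_eq_partialTime Δt hk.le, switchTime_eq_partialTime Δt (k := k + 1) hk,
      if_pos ⟨ht.1, Or.inl ht.2⟩]
  · intro l _ hl
    rw [switchTime_eq_partialTime Δt l.2.le, switchTime_eq_partialTime Δt (k := l + 1) l.2,
      switchTime_eq_partialTime Δt le_rfl]
    refine if_neg fun h => ?_
    rcases lt_trichotomy (l : ℕ) k with hlk | hlk | hlk
    · rcases h.2 with h2 | h2
      · exact (h2.trans_le (hmono (Nat.succ_le_of_lt hlk))).not_ge ht.1
      · omega
    · exact hl (Fin.ext hlk)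
    · exact (ht.2.trans_le (hmono (Nat.succ_le_of_lt hlk))).not_ge h.1
  · simp

theorem gramian_eq_integral {m : ℕ} {A : Fin m → ℝ → Matrix (Fin n) (Fin n) ℝ} {Δt : Fin m → ℝ}
    {X Y F : ℕ → ℝ → Matrix (Fin n) (Fin n) ℝ} (hF : ∀ k, IsFundamentalPair (F k) (X k) (Y k))
    (hFc : ∀ k, Continuous (F k)) (hΔ : ∀ k, 0 ≤ Δt k)
    (hA : ∀ k : Fin m, ∀ t ∈ Icc 0 (Δt k), F k t = A k t) (p : Fin n → ℝ) :
    gramian A Δt p = Matrix.of fun i j => ∫ τ in (0 : ℝ)..partialTime (extendZero Δt) m,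
      (flowLeft X (extendZero Δt) m * pathRight Y (extendZero Δt) m τ * Matrix.diagonal p *
        (flowLeft X (extendZero Δt) m * pathRight Y (extendZero Δt) m τ).transpose) i j := by
  have hδ := extendZero_nonneg hΔ
  have hT : 0 ≤ partialTime (extendZero Δt) m := by
    simpa [partialTime_zero] using partialTime_mono hδ (Nat.zero_le m)
  ext i j
  simp only [gramian, Matrix.of_apply]
  rw [switchTime_eq_partialTime Δt le_rfl]
  refine intervalIntegral.integral_congr fun τ hτ => ?_
  rw [uIcc_of_le hT] at hτ
  rw [stateTransition_eq_path (X := X) (Y := Y) hF ?_ hFc hδ ⟨hT, le_rfl⟩ hτ,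
    pathLeft_partialTime hδ]
  intro k hk t ht
  rw [systemMatrix_of_mem A hΔ hk ht]
  have ht' := ht.2
  rw [partialTime_succ, extendZero_of_lt Δt hk] at ht'
  exact (hA ⟨k, hk⟩ _ ⟨sub_nonneg.2 ht.1, by linarith⟩).symm

/-- Sufficient condition for both problems to have a unique optimal solution. -/
theorem existsUnique_optimal (hn : 1 ≤ n) {m : ℕ} {A : Fin m → ℝ → Matrix (Fin n) (Fin n) ℝ}
    {Δt : Fin m → ℝ} {X Y F : ℕ → ℝ → Matrix (Fin n) (Fin n) ℝ}
    (hF : ∀ k, IsFundamentalPair (F k) (X k) (Y k))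
    (hFc : ∀ k, Continuous (F k)) (hΔ : ∀ k, 0 ≤ Δt k)
    (hT : 0 < partialTime (extendZero Δt) m)
    (hA : ∀ k : Fin m, ∀ t ∈ Icc 0 (Δt k), F k t = A k t)
    (hdet : (Matrix.of fun i j => gramianSum X Y m (Pi.single i 1) (extendZero Δt) j j).det ≠ 0) :
    (∃! p, IsVolumetricOptimal A Δt p) ∧ ∃! p, IsAverageEnergyOptimal A Δt p := by
  have hδ := extendZero_nonneg hΔ
  set δ := extendZero Δt
  set W : Fin n → Matrix (Fin n) (Fin n) ℝ := fun i => gramianSum X Y m (Pi.single i 1) δ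
  have hgr := gramian_eq_integral hF hFc hΔ hA
  have hW : ∀ p, gramian A Δt p = ∑ i, p i • W i := fun p => by
    rw [hgr, integral_path_eq_gramianSum hF hδ,
      gramianSum_eq_sum fun k => (hF k).continuous_right]
  set C : ℝ → Matrix (Fin n) (Fin n) ℝ := fun τ => flowLeft X δ m * pathRight Y δ m τ
  have hC : Continuous C := continuous_const.matrix_mul (continuous_pathRight hF)
  -- Comparing only diagonal entries gives a square linear system for `p - q`, with the invertible
  -- matrix of `hdet`.
  have hinj : Function.Injective fun p : Fin n → ℝ => ∑ i, p i • W i := by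
    intro p q hpq
    have h0 : Matrix.vecMul (p - q) (Matrix.of fun i j => W i j j) = 0 := by
      ext j
      have := congrFun (congrFun hpq j) j
      simp only [Matrix.sum_apply, Matrix.smul_apply, smul_eq_mul] at this
      simp only [Matrix.vecMul, dotProduct, Matrix.of_apply, Pi.sub_apply, sub_mul,
        Finset.sum_sub_distrib, this, sub_self, Pi.zero_apply]
    exact sub_eq_zero.1 (Matrix.eq_zero_of_vecMul_eq_zero hdet h0)
  have hpsd : ∀ p ∈ stdSimplex ℝ (Fin n), (∑ i, p i • W i).PosSemidef := fun p hp => by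
    rw [← hW, hgr]
    refine posSemidef_integral hT.le (continuous_mul_diagonal_mul_transpose hC p) fun t => ?_
    exact (Matrix.PosSemidef.diagonal hp.1).mul_mul_conjTranspose_same (C t)
  have hn' : (0 : ℝ) < n := by exact_mod_cast hn
  -- Uniform weights have no zero entry, so the integrand is positive definite at every time.
  have hp₀ : (fun _ => (n : ℝ)⁻¹ : Fin n → ℝ) ∈ stdSimplex ℝ (Fin n) :=
    ⟨fun _ => by positivity, by simp [hn'.ne']⟩
  have hpos : (∑ i : Fin n, (n : ℝ)⁻¹ • W i).PosDef := by
    rw [← hW fun _ => (n : ℝ)⁻¹, hgr]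
    refine posDef_integral hT (continuous_mul_diagonal_mul_transpose hC _) fun t => ?_
    refine (Matrix.PosDef.diagonal fun _ => by positivity).mul_mul_conjTranspose_same
      (B := C t) (Matrix.vecMul_injective_of_isUnit ?_)
    have h1 : IsUnit (flowLeft X δ m) :=
      .of_mul_eq_one _ (mul_eq_one_comm.1
        (flowRight_mul_flowLeft (fun k => (hF k).right_mul_left) δ m))
    exact h1.mul (.of_mul_eq_one _ (pathRight_mul_pathLeft hF))
  simp only [IsVolumetricOptimal, IsAverageEnergyOptimal, feasible, hW]
  exact ⟨existsUnique_volumetric hinj hpsd hp₀ hpos, existsUnique_averageEnergy hinj hpsd hp₀ hpos⟩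

/-! ### Analytic dependence on the durations -/

variable {m : ℕ}

section Analytic

variable {E : Type*} [NormedAddCommGroup E] [NormedSpace ℝ E] {x₀ : E}

theorem analyticAt_matrix_mul {M N : E → Matrix (Fin n) (Fin n) ℝ}
    (hM : ∀ i j, AnalyticAt ℝ (fun x => M x i j) x₀)
    (hN : ∀ i j, AnalyticAt ℝ (fun x => N x i j) x₀) (i j : Fin n) :
    AnalyticAt ℝ (fun x => (M x * N x) i j) x₀ := by
  simp only [Matrix.mul_apply]
  exact Finset.analyticAt_fun_sum _ fun k _ => (hM i k).mul (hN k j)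

theorem analyticAt_matrix_det {M : E → Matrix (Fin n) (Fin n) ℝ}
    (hM : ∀ i j, AnalyticAt ℝ (fun x => M x i j) x₀) : AnalyticAt ℝ (fun x => (M x).det) x₀ := by
  simp only [Matrix.det_apply']
  exact Finset.analyticAt_fun_sum _ fun σ _ =>
    analyticAt_const.mul (Finset.analyticAt_fun_prod _ fun i _ => hM _ _)

theorem analyticAt_flowLeft {X : ℕ → ℝ → Matrix (Fin n) (Fin n) ℝ} {δ : E → ℕ → ℝ}
    (k : ℕ) (hX : ∀ l < k, ∀ i j, AnalyticAt ℝ (fun x => X l (δ x l) i j) x₀) (i j : Fin n) :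
    AnalyticAt ℝ (fun x => flowLeft X (δ x) k i j) x₀ := by
  induction k generalizing i j with
  | zero => exact analyticAt_const
  | succ k ih =>
    exact analyticAt_matrix_mul (hX k k.lt_succ_self)
      (ih fun l hl => hX l (hl.trans k.lt_succ_self)) i j

theorem analyticAt_flowRight {Y : ℕ → ℝ → Matrix (Fin n) (Fin n) ℝ} {δ : E → ℕ → ℝ}
    (k : ℕ) (hY : ∀ l < k, ∀ i j, AnalyticAt ℝ (fun x => Y l (δ x l) i j) x₀) (i j : Fin n) :
    AnalyticAt ℝ (fun x => flowRight Y (δ x) k i j) x₀ := by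
  induction k generalizing i j with
  | zero => exact analyticAt_const
  | succ k ih =>
    exact analyticAt_matrix_mul (ih fun l hl => hY l (hl.trans k.lt_succ_self))
      (hY k k.lt_succ_self) i j

/-- Its derivative in the upper limit is the integrand, which is analytic at `x`. -/
theorem analyticAt_pieceGramian {Y : ℝ → Matrix (Fin n) (Fin n) ℝ} (hYc : Continuous Y)
    {x : ℝ} (hY : ∀ i j, AnalyticAt ℝ (fun t => Y t i j) x) (p : Fin n → ℝ) (i j : Fin n) :
    AnalyticAt ℝ (fun x => pieceGramian Y p x i j) x := by
  have h1 : ∀ i j, AnalyticAt ℝ (fun t => (Y t * Matrix.diagonal p) i j) x :=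
    analyticAt_matrix_mul hY fun _ _ => analyticAt_const
  have h2 : AnalyticAt ℝ (fun t => (Y t * Matrix.diagonal p * (Y t).transpose) i j) x :=
    analyticAt_matrix_mul (N := fun t => (Y t).transpose) h1 (fun i j => hY j i) i j
  exact analyticAt_of_hasDerivAt h2
    (Eventually.of_forall fun t => hasDerivAt_pieceGramian hYc p t i j)

theorem analyticAt_gramianSum {X Y : ℕ → ℝ → Matrix (Fin n) (Fin n) ℝ}
    (hYc : ∀ k, Continuous (Y k)) {δ : E → ℕ → ℝ}
    (hδ : ∀ k < m, AnalyticAt ℝ (fun x => δ x k) x₀)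
    (hX : ∀ k < m, ∀ i j, AnalyticAt ℝ (fun t => X k t i j) (δ x₀ k))
    (hY : ∀ k < m, ∀ i j, AnalyticAt ℝ (fun t => Y k t i j) (δ x₀ k)) (p : Fin n → ℝ)
    (i j : Fin n) : AnalyticAt ℝ (fun x => gramianSum X Y m p (δ x) i j) x₀ := by
  simp only [gramianSum, Matrix.sum_apply]
  refine Finset.analyticAt_fun_sum _ fun k hk => ?_
  have hk' := Finset.mem_range.1 hk
  have hN : ∀ i j, AnalyticAt ℝ
      (fun x => (flowLeft X (δ x) m * flowRight Y (δ x) k) i j) x₀ :=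
    analyticAt_matrix_mul
      (analyticAt_flowLeft m fun l hl i j =>
        (hX l hl i j).comp_of_eq (f := fun x => δ x l) (hδ l hl) rfl)
      (analyticAt_flowRight k fun l hl i j =>
        (hY l (hl.trans hk') i j).comp_of_eq (f := fun x => δ x l) (hδ l (hl.trans hk')) rfl)
  have hH : ∀ i j, AnalyticAt ℝ (fun x => pieceGramian (Y k) p (δ x k) i j) x₀ := fun i j =>
    (analyticAt_pieceGramian (hYc k) (hY k hk') p i j).comp_of_eq (f := fun x => δ x k)
      (hδ k hk') rfl
  exact analyticAt_matrix_mul (analyticAt_matrix_mul hN hH) (fun i j => hN j i) i j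

end Analytic

/-! ### Nonvanishing of the determinant for short durations -/

/-- The determinant whose nonvanishing makes `p ↦ W(p; Δt)` injective. -/
noncomputable def diagonalDet (X Y : ℕ → ℝ → Matrix (Fin n) (Fin n) ℝ) (Δt : Fin m → ℝ) : ℝ :=
  (Matrix.of fun i j => gramianSum X Y m (Pi.single i 1) (extendZero Δt) j j).det

/-- This is the derivative at `ε = 0`: the integrand there is `diagonal p` because `Y 0 = 1`, and
the chain rule contributes `c`. -/
theorem tendsto_inv_smul_pieceGramian {Y : ℝ → Matrix (Fin n) (Fin n) ℝ} (hY : Continuous Y)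
    (hY0 : Y 0 = 1) (p : Fin n → ℝ) (c : ℝ) :
    Tendsto (fun ε : ℝ => ε⁻¹ • pieceGramian Y p (ε * c)) (𝓝[≠] 0)
      (𝓝 (c • Matrix.diagonal p)) := by
  refine tendsto_pi_nhds.2 fun i => tendsto_pi_nhds.2 fun j => ?_
  have h1 : HasDerivAt (fun ε : ℝ => ε * c) c 0 := by
    simpa using (hasDerivAt_id (0 : ℝ)).mul_const c
  have h2 := (hasDerivAt_pieceGramian hY p (0 * c) i j).comp (0 : ℝ) h1
  rw [zero_mul, hY0, Matrix.one_mul, Matrix.transpose_one, Matrix.mul_one] at h2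
  have h3 := hasDerivAt_iff_tendsto_slope_zero.1 h2
  simpa [pieceGramian, mul_comm c] using! h3

theorem tendsto_inv_smul_gramianSum {X Y : ℕ → ℝ → Matrix (Fin n) (Fin n) ℝ}
    (hX : ∀ k, Continuous (X k)) (hY : ∀ k, Continuous (Y k)) (hX0 : ∀ k, X k 0 = 1)
    (hY0 : ∀ k, Y k 0 = 1) (p : Fin n → ℝ) (σ : ℕ → ℝ) :
    Tendsto (fun ε : ℝ => ε⁻¹ • gramianSum X Y m p fun k => ε * σ k) (𝓝[≠] 0)
      (𝓝 ((∑ k ∈ Finset.range m, σ k) • Matrix.diagonal p)) := by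
  have hN : ∀ k, Tendsto (fun ε : ℝ => flowLeft X (fun k => ε * σ k) m *
      flowRight Y (fun k => ε * σ k) k) (𝓝[≠] 0) (𝓝 1) := fun k => by
    have hc : Continuous fun ε : ℝ => flowLeft X (fun k => ε * σ k) m *
        flowRight Y (fun k => ε * σ k) k :=
      (continuous_flowLeft hX (fun k => by fun_prop) m).matrix_mul
        (continuous_flowRight hY (fun k => by fun_prop) k)
    have h := (hc.tendsto 0).mono_left (nhdsWithin_le_nhds (s := {0}ᶜ))
    rwa [flowLeft_of_zero hX0 (Nat.zero_le m) fun l _ => zero_mul _,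
      flowRight_of_zero hY0 (Nat.zero_le k) fun l _ => zero_mul _, flowLeft, flowRight,
      Matrix.one_mul] at h
  have hmul : Continuous fun q : Matrix (Fin n) (Fin n) ℝ × Matrix (Fin n) (Fin n) ℝ =>
      q.1 * q.2 * q.1.transpose :=
    (continuous_fst.matrix_mul continuous_snd).matrix_mul continuous_fst.matrix_transpose
  rw [Finset.sum_smul]
  simp only [gramianSum, Finset.smul_sum]
  refine tendsto_finsetSum _ fun k _ => ?_
  have h := (hmul.tendsto (1, σ k • Matrix.diagonal p)).comp
    ((hN k).prodMk_nhds (tendsto_inv_smul_pieceGramian (hY k) (hY0 k) p (σ k)))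
  simpa [Function.comp_def] using h

/-- Along `Δt = ε s` the array of diagonals, divided by `ε`, tends to `S • 1`, whose determinant is
`S ^ n`. Small positive `ε` keep the point inside the box, and the scaling by `ε⁻¹` cannot make a
zero determinant nonzero. -/
theorem exists_diagonalDet_ne_zero {X Y : ℕ → ℝ → Matrix (Fin n) (Fin n) ℝ}
    (hX : ∀ k, Continuous (X k)) (hY : ∀ k, Continuous (Y k)) (hX0 : ∀ k, X k 0 = 1)
    (hY0 : ∀ k, Y k 0 = 1) (hm : 1 ≤ m) {s : Fin m → ℝ} (hs : ∀ k, 0 < s k) :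
    ∃ Δt ∈ univ.pi fun k => Ioo 0 (s k), diagonalDet X Y Δt ≠ 0 := by
  set S := ∑ k ∈ Finset.range m, extendZero s k
  have hS : 0 < S := Finset.sum_pos (fun k hk => by
    rw [extendZero_of_lt s (Finset.mem_range.1 hk)]; exact hs _) ⟨0, Finset.mem_range.2 hm⟩
  have hlim : Tendsto (fun ε : ℝ => (Matrix.of fun i j : Fin n =>
      (ε⁻¹ • gramianSum X Y m (Pi.single i 1) fun k => ε * extendZero s k) j j).det) (𝓝[≠] 0)
      (𝓝 (S • (1 : Matrix (Fin n) (Fin n) ℝ)).det) := by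
    refine ((continuous_id.matrix_det).tendsto _).comp ?_
    refine tendsto_pi_nhds.2 fun i => tendsto_pi_nhds.2 fun j => ?_
    have h := tendsto_pi_nhds.1 (tendsto_pi_nhds.1 (tendsto_inv_smul_gramianSum (m := m) hX hY hX0
      hY0 (Pi.single i 1) (extendZero s)) j) j
    convert! h using 2
    simp [S, Matrix.one_apply, Pi.single_apply, eq_comm]
  have hne : (S • (1 : Matrix (Fin n) (Fin n) ℝ)).det ≠ 0 := by
    rw [Matrix.det_smul, Matrix.det_one, mul_one]
    exact pow_ne_zero _ hS.ne'
  have hev := (hlim.eventually_ne hne).filter_mono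
    (nhdsWithin_mono 0 fun (ε : ℝ) (h : ε ∈ Ioi 0) => (mem_Ioi.1 h).ne')
  obtain ⟨ε, hε, hε01⟩ := (hev.and (Ioo_mem_nhdsGT (one_pos (α := ℝ)))).exists
  refine ⟨fun k => ε * s k, fun k _ => ⟨mul_pos hε01.1 (hs k), by nlinarith [hs k, hε01.2]⟩,
    fun h0 => hε ?_⟩
  have hext : extendZero (fun k => ε * s k) = fun k => ε * extendZero s k := by
    funext k
    unfold extendZero
    split_ifs <;> simp
  rw [diagonalDet, hext] at h0
  have : (Matrix.of fun i j : Fin n =>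
      (ε⁻¹ • gramianSum X Y m (Pi.single i 1) fun k => ε * extendZero s k) j j) =
      ε⁻¹ • Matrix.of fun i j : Fin n =>
        gramianSum X Y m (Pi.single i 1) (fun k => ε * extendZero s k) j j := rfl
  rw [this, Matrix.det_smul, h0, mul_zero]

/-! ### Generic durations and conclusion -/

theorem admissible_eq_pi (s : Fin m → ℝ) : admissible s = univ.pi fun k => Icc 0 (s k) :=
  Set.ext fun _ => ⟨fun h k _ => h k, fun h k => h k trivial⟩

/-- An analytic function which is nonzero at an interior point of `D` is nonzero on a subset of `D`
that is dense, open in `D` and of full measure. -/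
theorem dense_conull_of_analytic {s : Fin m → ℝ} (hs : ∀ k, 0 < s k) {f : (Fin m → ℝ) → ℝ}
    (hf : AnalyticOnNhd ℝ f (univ.pi fun k => Ioo 0 (s k)))
    (hne : ∃ x ∈ univ.pi fun k => Ioo 0 (s k), f x ≠ 0) {G : Set (Fin m → ℝ)}
    (hG : ∀ x ∈ univ.pi fun k => Ioo 0 (s k), f x ≠ 0 → x ∈ G) :
    ContainsDenseOpenSubset (admissible s) G ∧ volume (admissible s \ G) = 0 := by
  obtain ⟨x, hx, hfx⟩ := hne
  have hnull := volume_zeros_box hf hx hfx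
  set B := univ.pi fun k => Ioo 0 (s k)
  have hBo : IsOpen B := isOpen_set_pi finite_univ fun _ _ => isOpen_Ioo
  have hD := admissible_eq_pi s
  have hBD : B ⊆ admissible s := by
    rw [hD]; exact pi_mono fun _ _ => Ioo_subset_Icc_self
  have hclB : closure B = admissible s := by
    rw [closure_pi_set, hD]
    simp only [closure_Ioo (hs _).ne]
  have hUo : IsOpen (B ∩ f ⁻¹' {0}ᶜ) :=
    hf.continuousOn.isOpen_inter_preimage hBo isOpen_compl_singleton
  refine ⟨⟨B ∩ f ⁻¹' {0}ᶜ, fun x hx => hG x hx.1 hx.2, ⟨_, hUo, ?_⟩, ?_⟩, ?_⟩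
  · exact (inter_eq_right.2 (inter_subset_left.trans hBD)).symm
  · rw [← hclB]
    refine closure_minimal (fun y hy => ?_) isClosed_closure
    refine mem_closure_iff.2 fun O hO hyO => ?_
    by_contra hemp
    -- Density follows from nullity: a nonempty open part of the box cannot lie in the zero set.
    have hpos := (hO.inter hBo).measure_pos volume ⟨y, hyO, hy⟩
    have hsub : O ∩ B ⊆ {t ∈ B | f t = 0} := fun z hz =>
      ⟨hz.2, by_contra fun h0 => hemp ⟨z, hz.1, hz.2, h0⟩⟩
    exact hpos.ne' (measure_mono_null hsub hnull)
  · have hbd : volume (admissible s \ B) = 0 := by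
      rw [hD, pi_univ_Icc]
      exact ae_le_set.1 (Measure.univ_pi_Ioo_ae_eq_Icc (μ := fun _ : Fin m => volume)).symm.le
    refine measure_mono_null (t := admissible s \ B ∪ {t ∈ B | f t = 0}) (fun y hy => ?_)
      (measure_union_null hbd hnull)
    by_cases hyB : y ∈ B
    · exact Or.inr ⟨hyB, by_contra fun h0 => hy.2 (hG y hyB h0)⟩
    · exact Or.inl ⟨hy.1, hyB⟩

theorem exists_fundamentalPairs {s : Fin m → ℝ} (hs : ∀ k, 0 < s k)
    {A : Fin m → ℝ → Matrix (Fin n) (Fin n) ℝ}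
    (ha : ∀ k i j, AnalyticOnNhd ℝ (fun t => A k t i j) (Ioo 0 (s k)))
    (hc : ∀ k i j, ContinuousOn (fun t => A k t i j) (Icc 0 (s k))) :
    ∃ F X Y : ℕ → ℝ → Matrix (Fin n) (Fin n) ℝ, (∀ k, IsFundamentalPair (F k) (X k) (Y k)) ∧
      (∀ k, Continuous (F k)) ∧ (∀ k : Fin m, ∀ t ∈ Icc 0 (s k), F k t = A k t) ∧
      (∀ k : Fin m, ∀ i j, ∀ t ∈ Ioo 0 (s k), AnalyticAt ℝ (fun t => X k t i j) t) ∧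
      ∀ k : Fin m, ∀ i j, ∀ t ∈ Ioo 0 (s k), AnalyticAt ℝ (fun t => Y k t i j) t := by
  have key : ∀ k : ℕ, ∃ F X Y : ℝ → Matrix (Fin n) (Fin n) ℝ, IsFundamentalPair F X Y ∧
      Continuous F ∧ ∀ h : k < m, (∀ t ∈ Icc 0 (s ⟨k, h⟩), F t = A ⟨k, h⟩ t) ∧
      (∀ i j, ∀ t ∈ Ioo 0 (s ⟨k, h⟩), AnalyticAt ℝ (fun t => X t i j) t) ∧
      ∀ i j, ∀ t ∈ Ioo 0 (s ⟨k, h⟩), AnalyticAt ℝ (fun t => Y t i j) t := fun k => by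
    by_cases h : k < m
    · obtain ⟨X, Y, hXY, hX, hY⟩ := exists_isFundamentalPair (hs ⟨k, h⟩) (hc ⟨k, h⟩) (ha ⟨k, h⟩)
      refine ⟨_, X, Y, hXY, ?_, fun _ => ⟨fun t ht => ?_, hX, hY⟩⟩
      · refine continuous_matrix fun i j => (hc ⟨k, h⟩ i j).comp_continuous
          (f := fun t => max 0 (min t (s ⟨k, h⟩))) (by fun_prop)
          fun t => ⟨le_max_left _ _, max_le (hs _).le (min_le_right _ _)⟩
      · rw [min_eq_left ht.2, max_eq_right ht.1]
    -- Indices beyond the last piece receive the zero system as a harmless default.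
    · refine ⟨fun _ => 0, fun _ => 1, fun _ => 1, ⟨rfl, rfl, fun t i j => ?_, fun t i j => ?_⟩,
        continuous_const, fun h' => absurd h' h⟩
      · simpa using hasDerivAt_const t ((1 : Matrix (Fin n) (Fin n) ℝ) i j)
      · simpa using hasDerivAt_const t ((1 : Matrix (Fin n) (Fin n) ℝ) i j)
  choose F X Y hXY hFc h using key
  exact ⟨F, X, Y, hXY, hFc, fun k => (h k k.2).1, fun k => (h k k.2).2.1, fun k => (h k k.2).2.2⟩

end LTV

theorem mainTheorem1 {n m : ℕ} (hn : 1 ≤ n) (hm : 1 ≤ m)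
    (s : Fin m → ℝ) (hs : ∀ k, 0 < s k)
    (A : Fin m → ℝ → Matrix (Fin n) (Fin n) ℝ)
    (hA_analytic : ∀ k i j, AnalyticOnNhd ℝ (fun t => A k t i j) (Set.Ioo 0 (s k)))
    (hA_continuous : ∀ k i j, ContinuousOn (fun t => A k t i j) (Set.Icc 0 (s k))) :
    LTV.ContainsDenseOpenSubset (LTV.admissible s) (LTV.uniqueVolumetric s A) ∧
    LTV.ContainsDenseOpenSubset (LTV.admissible s) (LTV.uniqueAverageEnergy s A) ∧
    MeasureTheory.volume (LTV.admissible s \ LTV.uniqueVolumetric s A) = 0 ∧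
    MeasureTheory.volume (LTV.admissible s \ LTV.uniqueAverageEnergy s A) = 0 ∧
    ∀ᵐ Δt ∂(MeasureTheory.volume.restrict (LTV.admissible s)),
      (∃! p, LTV.IsVolumetricOptimal A Δt p) ∧ (∃! p, LTV.IsAverageEnergyOptimal A Δt p) := by
  open LTV in
  obtain ⟨F, X, Y, hF, hFc, hFA, hXa, hYa⟩ := exists_fundamentalPairs hs hA_analytic hA_continuous
  have hYc : ∀ k, Continuous (Y k) := fun k => (hF k).continuous_right
  have hne := exists_diagonalDet_ne_zero (fun k => (hF k).continuous_left) hYc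
    (fun k => (hF k).left_zero) (fun k => (hF k).right_zero) hm hs
  have han : AnalyticOnNhd ℝ (diagonalDet X Y) (univ.pi fun k => Ioo 0 (s k)) := fun Δt hΔ => by
    refine analyticAt_matrix_det fun i j => analyticAt_gramianSum (δ := extendZero) hYc
      (fun k hk => ?_) (fun k hk i j => ?_) (fun k hk i j => ?_) _ _ _
    · simp only [extendZero_of_lt _ hk]
      exact (ContinuousLinearMap.proj (R := ℝ) (φ := fun _ : Fin m => ℝ) ⟨k, hk⟩).analyticAt Δt
    · rw [extendZero_of_lt _ hk]
      exact hXa ⟨k, hk⟩ i j _ (hΔ _ trivial)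
    · rw [extendZero_of_lt _ hk]
      exact hYa ⟨k, hk⟩ i j _ (hΔ _ trivial)
  have hopt : ∀ Δt ∈ univ.pi fun k => Ioo 0 (s k), diagonalDet X Y Δt ≠ 0 →
      Δt ∈ admissible s ∧
        (∃! p, IsVolumetricOptimal A Δt p) ∧ ∃! p, IsAverageEnergyOptimal A Δt p :=
    fun Δt hΔ hdet => by
    have h0 : ∀ k, 0 < Δt k ∧ Δt k < s k := fun k => hΔ k trivial
    refine ⟨fun k => ⟨(h0 k).1.le, (h0 k).2.le⟩, existsUnique_optimal hn hF hFc
      (fun k => (h0 k).1.le) ?_ (fun k t ht => hFA k t ⟨ht.1, ht.2.trans (h0 k).2.le⟩) hdet⟩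
    refine Finset.sum_pos (fun k hk => ?_) ⟨0, Finset.mem_range.2 hm⟩
    rw [extendZero_of_lt _ (Finset.mem_range.1 hk)]
    exact (h0 _).1
  obtain ⟨hV, hV0⟩ := dense_conull_of_analytic hs han hne (G := uniqueVolumetric s A)
    fun Δt hΔ hdet => ⟨(hopt Δt hΔ hdet).1, (hopt Δt hΔ hdet).2.1⟩
  obtain ⟨hE, hE0⟩ := dense_conull_of_analytic hs han hne (G := uniqueAverageEnergy s A)
    fun Δt hΔ hdet => ⟨(hopt Δt hΔ hdet).1, (hopt Δt hΔ hdet).2.2⟩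
  refine ⟨hV, hE, hV0, hE0, ?_⟩
  have hDm : MeasurableSet (admissible s) := by
    rw [admissible_eq_pi]
    exact MeasurableSet.univ_pi fun _ => measurableSet_Icc
  rw [ae_restrict_iff' hDm]
  filter_upwards [measure_eq_zero_iff_ae_notMem.1 hV0, measure_eq_zero_iff_ae_notMem.1 hE0]
    with Δt h1 h2 hD
  exact ⟨(not_not.1 fun h => h1 ⟨hD, h⟩ : Δt ∈ uniqueVolumetric s A).2,
    (not_not.1 fun h => h2 ⟨hD, h⟩ : Δt ∈ uniqueAverageEnergy s A).2⟩
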